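/- **Tiered multi-armed bandit with multiple source tasks.** Let $A\ge 2$, $W\ge 2$. A high-tier task $M_{\rm Hi}$ and source tasks $M_{{\rm Lo},1},\dots,M_{{\rm Lo},W}$ are stochastic bandits with common arm set $[A]$ and rewards in $[0,1]$; arm $i$ has mean $\mu_{\rm Hi}(i)$, resp. $\mu_{{\rm Lo},w}(i)$. Assume that every task has a unique optimal arm, denoted $i^*_{\rm Hi}$, $i^*_{{\rm Lo},w}$. Put $\Delta_{\rm Hi}(i)=\max_j\mu_{\rm Hi}(j)-\mu_{\rm Hi}(i)$, similarly $\Delta_{{\rm Lo},w}(i)$, and let $\Delta_{\min}>0$ be the smallest gap of a non-optimal arm over all $W+1$ tasks. Assume optimal value dominance, $\mu_{{\rm Lo},w}(i^*_{{\rm Lo},w})\ge\mu_{\rm Hi}(i^*_{\rm Hi})-\Delta_{\min}/2$ for all $w\in[W]$, and let $0\le\tilde\Delta_{\min}\le\Delta_{\min}$ be known to the learner. Call $M_{\rm Hi}$ and $M_{{\rm Lo},w}$ *$\epsilon$-close* if $\mu_{{\rm Lo},w}(i^*_{{\rm Lo},w})-\mu_{\rm Hi}(i^*_{\rm Hi})\le\epsilon$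 and $i^*_{{\rm Lo},w}=i^*_{\rm Hi}$. *Algorithm ("Trust till Failure"), parameters $\alpha>2$ and $\epsilon=\tilde\Delta_{\min}/4$.* In each round $k=1,2,\dots$ one arm is pulled in every task; $\pi^k_{\rm Hi}$ is the arm pulled in $M_{\rm Hi}$. In rounds $1,\dots,A$ each arm is pulled once in every task; set $w^A={\tt Null}$. For $k>A$ let $N^k(i)$ and $\hat\mu^k(i)$ be the number of pulls and the empirical mean of arm $i$ before round $k$ (in each task), let $f(k)=1+16WA^2(k+1)^2$, and let $\overline\mu^k(i),\underline\mu^k(i)=\hat\mu^k(i)\pm\sqrt{2\alpha\log f(k)/N^k(i)}$. In each source task $w$ pull an arm in $\arg\max_i\overline\mu^k_{{\rm Lo},w}(i)$ and let $\underline\pi^k_{{\rm Lo},w}\in\arg\max_i\underline\mu^k_{{\rm Lo},w}(i)$. Let $\mathcal I^k$ be the set of $w\in[W]$ with $\underline\mu^k_{{\rm Lo},w}(\underline\pi^k_{{\rm Lo},w})\le\overline\mu^k_{\rm Hi}(\underline\pi^k_{{\rm Lo},w})+\epsilon$ and $N^k_{{\rm Lo},w}(\underline\pi^k_{{\rm Lo},w})>k/2$.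 - If $\mathcal I^k=\emptyset$, set $w^k={\tt Null}$ and $\pi^k_{\rm Hi}\in\arg\max_i\overline\mu^k_{\rm Hi}(i)$. - Otherwise set $\pi^k_{\rm Hi}=\underline\pi^k_{{\rm Lo},w^k}$, where: $w^k=w^{k-1}$ if $w^{k-1}\ne{\tt Null}$ and $w^{k-1}\in\mathcal I^k$; else, if $w^{k-1}\neq{\tt Null}$ and some $w\in\mathcal I^k$ satisfies $\pi^{k-1}_{\rm Hi}\in\arg\max_iN^k_{{\rm Lo},w}(i)$, $w^k$ is such a $w$; else $w^k$ is drawn uniformly from $\mathcal I^k$. Ties are broken in any non-anticipating way. Let ${\rm Regret}_K(M_{\rm Hi})=\mathbb E\big[\sum_{k=1}^K(\mu_{\rm Hi}(i^*_{\rm Hi})-\mu_{\rm Hi}(\pi^k_{\rm Hi}))\big]$. **Theorem.** For every $\alpha>2$ there is a constant $C>0$ depending only on $\alpha$ such that, in the setting above, for all $K\ge1$, $$ {\rm Regret}_K(M_{\rm Hi})\le C\sum_{i:\Delta_{\rm Hi}(i)>0}\frac1{\Delta_{\rm Hi}(i)}\log(WK). $$ If moreover at least one source task is $\tilde\Delta_{\min}/4$-close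 to $M_{\rm Hi}$, then for all $K\ge1$, $$ {\rm Regret}_K(M_{\rm Hi})\le C\sum_{i:\Delta_{\rm Hi}(i)>0}\frac1{\Delta_{\rm Hi}(i)}\log\frac{AW}{\Delta_{\min}}, $$ a bound independent of $K$. -/

import Mathlib

open MeasureTheory ProbabilityTheory

noncomputable section

/-- A stochastic bandit task with arms `Fin A`: pulling arm `i` yields a reward with distribution
`law i`, a probability distribution on `[0, 1]`. -/
structure BanditTask (A : ℕ) where
  law : Fin A → Measure ℝ
  isProb : ∀ i, IsProbabilityMeasure (law i)
  mem_Icc : ∀ i, ∀ᵐ x ∂(law i), x ∈ Set.Icc (0 : ℝ) 1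

namespace BanditTask

variable {A W : ℕ}

/-- Expected reward of arm `i`. -/
def mean (M : BanditTask A) (i : Fin A) : ℝ := ∫ x, x ∂(M.law i)

/-- The optimal value `max_i mean i`. -/
def optValue (M : BanditTask A) : ℝ := ⨆ i, M.mean i

/-- The gap of arm `i`. -/
def gap (M : BanditTask A) (i : Fin A) : ℝ := M.optValue - M.mean i

/-- Arm `i` has the largest expected reward. -/
def IsOptimal (M : BanditTask A) (i : Fin A) : Prop := ∀ j, M.mean j ≤ M.mean i

/-- The smallest gap of a non-optimal arm. -/
def minGap (M : BanditTask A) : ℝ := ⨅ i : {i : Fin A // ¬ M.IsOptimal i}, M.gap i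

/-- The smallest gap over the high-tier task and all source tasks. -/
def jointMinGap (Hi : BanditTask A) (Lo : Fin W → BanditTask A) : ℝ :=
  min Hi.minGap (⨅ w, (Lo w).minGap)

/-- `Hi` is `ε`-close to `Lo`: the optimal value of `Lo` exceeds that of `Hi` by at most `ε`,
and both tasks have the same optimal arms. -/
def IsClose (ε : ℝ) (Hi Lo : BanditTask A) : Prop :=
  Lo.optValue - Hi.optValue ≤ ε ∧ ∀ i, Hi.IsOptimal i ↔ Lo.IsOptimal i

end BanditTask

section Statistics

variable {A : ℕ} {Ω : Type*}

/-- Number of pulls of arm `i` in the rounds `1, …, k - 1`. -/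
def pullCount (arm : ℕ → Ω → Fin A) (k : ℕ) (i : Fin A) (ω : Ω) : ℕ :=
  ((Finset.Ico 1 k).filter fun j => arm j ω = i).card

/-- Empirical mean of the rewards of arm `i` over the rounds `1, …, k - 1`
(`0` if arm `i` has not been pulled). -/
def empMean (arm : ℕ → Ω → Fin A) (rew : ℕ → Ω → ℝ) (k : ℕ) (i : Fin A) (ω : Ω) : ℝ :=
  (∑ j ∈ (Finset.Ico 1 k).filter (fun j => arm j ω = i), rew j ω) / (pullCount arm k i ω : ℝ)

/-- `f(k) = 1 + 16 W A² (k + 1)²`. -/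
def confFn (A W k : ℕ) : ℝ := 1 + 16 * (W : ℝ) * (A : ℝ) ^ 2 * ((k : ℝ) + 1) ^ 2

/-- The confidence width `√(2 α log f(k) / N^k(i))`. -/
def confWidth (α : ℝ) (W : ℕ) (arm : ℕ → Ω → Fin A) (k : ℕ) (i : Fin A) (ω : Ω) : ℝ :=
  Real.sqrt (2 * α * Real.log (confFn A W k) / (pullCount arm k i ω : ℝ))

/-- Upper confidence bound of arm `i` at the beginning of round `k`. -/
def ucb (α : ℝ) (W : ℕ) (arm : ℕ → Ω → Fin A) (rew : ℕ → Ω → ℝ) (k : ℕ) (i : Fin A) (ω : Ω) : ℝ :=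
  empMean arm rew k i ω + confWidth α W arm k i ω

/-- Lower confidence bound of arm `i` at the beginning of round `k`. -/
def lcb (α : ℝ) (W : ℕ) (arm : ℕ → Ω → Fin A) (rew : ℕ → Ω → ℝ) (k : ℕ) (i : Fin A) (ω : Ω) : ℝ :=
  empMean arm rew k i ω - confWidth α W arm k i ω

/-- Conditionally on the information `m`, the variable `X` has distribution `κ ω`. -/
def HasCondLaw [MeasurableSpace Ω] (P : Measure Ω) (m : MeasurableSpace Ω) (X : Ω → ℝ)
    (κ : Ω → Measure ℝ) : Prop :=
  ∀ B : Set ℝ, MeasurableSet B → P⟦X ⁻¹' B|m⟧ =ᵐ[P] fun ω => (κ ω).real B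

end Statistics

/-- The random quantities produced while interacting with one high-tier task and `W` source tasks.
Rounds are numbered `1, 2, 3, …`; the values at index `0` play no role. -/
structure TieredTrace (A W : ℕ) (Ω : Type*) where
  /-- arm pulled in source task `w` in round `k` -/
  armLo : Fin W → ℕ → Ω → Fin A
  /-- reward received from source task `w` in round `k` -/
  rewLo : Fin W → ℕ → Ω → ℝ
  /-- the arm of source task `w` maximising the lower confidence bound in round `k` -/
  lcbArm : Fin W → ℕ → Ω → Fin A
  /-- the trusted source task in round `k`, where `none` stands for `Null` -/
  task : ℕ → Ω → Option (Fin W)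
  /-- arm pulled in the high-tier task in round `k` -/
  armHi : ℕ → Ω → Fin A
  /-- reward received from the high-tier task in round `k` -/
  rewHi : ℕ → Ω → ℝ

namespace TieredTrace

variable {A W : ℕ} {Ω : Type*}

/-- Information generated by the decisions of round `k`. -/
abbrev decisionInfo (T : TieredTrace A W Ω) (k : ℕ) : MeasurableSpace Ω :=
  (⨆ w, MeasurableSpace.comap (T.armLo w k) ⊤) ⊔ (⨆ w, MeasurableSpace.comap (T.lcbArm w k) ⊤) ⊔
    MeasurableSpace.comap (T.task k) ⊤ ⊔ MeasurableSpace.comap (T.armHi k) ⊤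

/-- Information generated by the rewards of round `k`. -/
abbrev rewardInfo (T : TieredTrace A W Ω) (k : ℕ) : MeasurableSpace Ω :=
  (⨆ w, MeasurableSpace.comap (T.rewLo w k) inferInstance) ⊔
    MeasurableSpace.comap (T.rewHi k) inferInstance

/-- The history before round `k`: all decisions and rewards of the rounds `1, …, k - 1`. -/
abbrev history (T : TieredTrace A W Ω) (k : ℕ) : MeasurableSpace Ω :=
  ⨆ j ∈ Finset.Ico 1 k, (T.decisionInfo j ⊔ T.rewardInfo j)

/-- The set `I^k` of source tasks that pass the checking event in round `k`. -/
def passing (T : TieredTrace A W Ω) (α ε : ℝ) (k : ℕ) (ω : Ω) : Finset (Fin W) :=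
  Finset.univ.filter fun w =>
    lcb α W (T.armLo w) (T.rewLo w) k (T.lcbArm w k ω) ω ≤
        ucb α W T.armHi T.rewHi k (T.lcbArm w k ω) ω + ε ∧
      (k : ℝ) / 2 < (pullCount (T.armLo w) k (T.lcbArm w k ω) ω : ℝ)

/-- The previously trusted task is still in `I^k`. -/
def CanKeep (T : TieredTrace A W Ω) (α ε : ℝ) (k : ℕ) (ω : Ω) : Prop :=
  ∃ w ∈ T.passing α ε k ω, T.task (k - 1) ω = some w

/-- Task `w` is in `I^k`, and the high-tier arm of round `k - 1` is its most pulled arm. -/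
def Inherits (T : TieredTrace A W Ω) (α ε : ℝ) (k : ℕ) (ω : Ω) (w : Fin W) : Prop :=
  w ∈ T.passing α ε k ω ∧
    ∀ i, pullCount (T.armLo w) k i ω ≤ pullCount (T.armLo w) k (T.armHi (k - 1) ω) ω

/-- In round `k` the trusted task is drawn uniformly from `I^k`: the set `I^k` is nonempty and
neither the previous task nor the previous action can be kept. -/
def Resamples (T : TieredTrace A W Ω) (α ε : ℝ) (k : ℕ) (ω : Ω) : Prop :=
  (T.passing α ε k ω).Nonempty ∧ ¬ T.CanKeep α ε k ω ∧
    ¬ (T.task (k - 1) ω ≠ none ∧ ∃ w, T.Inherits α ε k ω w)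

/-- `T` is a run of the "Trust till Failure" algorithm with parameters `α` and `ε` on the
high-tier task `Hi` and the source tasks `Lo`, on the probability space `(Ω, P)`.
Ties in every `argmax` (and the choice among several tasks that recommend the previous action)
are broken in an arbitrary, possibly random, non-anticipating way. The joint law of the rewards
that different tasks give in the same round is left free; independent rewards are one case. -/
structure IsTrustRun [MeasurableSpace Ω] (T : TieredTrace A W Ω) (P : Measure Ω) (α ε : ℝ)
    (Hi : BanditTask A) (Lo : Fin W → BanditTask A) : Prop where
  measurable_armLo : ∀ w k, Measurable (T.armLo w k)
  measurable_rewLo : ∀ w k, Measurable (T.rewLo w k)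
  measurable_lcbArm : ∀ w k, Measurable (T.lcbArm w k)
  measurable_task : ∀ k, Measurable[_, ⊤] (T.task k)
  measurable_armHi : ∀ k, Measurable (T.armHi k)
  measurable_rewHi : ∀ k, Measurable (T.rewHi k)
  /-- Given the history and the decisions of round `k`, the reward of source task `w` follows the
  law of the pulled arm. -/
  law_rewLo : ∀ w k, 1 ≤ k → HasCondLaw P (T.history k ⊔ T.decisionInfo k) (T.rewLo w k)
    fun ω => (Lo w).law (T.armLo w k ω)
  /-- Given the history and the decisions of round `k`, the reward of the high-tier task follows
  the law of the pulled arm. -/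
  law_rewHi : ∀ k, 1 ≤ k → HasCondLaw P (T.history k ⊔ T.decisionInfo k) (T.rewHi k)
    fun ω => Hi.law (T.armHi k ω)
  /-- Each arm of each task is pulled (hence exactly once) in the rounds `1, …, A`. -/
  init_armLo : ∀ w ω i, ∃ k ∈ Finset.Icc 1 A, T.armLo w k ω = i
  init_armHi : ∀ ω i, ∃ k ∈ Finset.Icc 1 A, T.armHi k ω = i
  init_task : ∀ ω, T.task A ω = none
  /-- Every source task is played by UCB. -/
  armLo_ucb : ∀ w k, A < k → ∀ ω i,
    ucb α W (T.armLo w) (T.rewLo w) k i ω ≤ ucb α W (T.armLo w) (T.rewLo w) k (T.armLo w k ω) ω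
  lcbArm_lcb : ∀ w k, A < k → ∀ ω i,
    lcb α W (T.armLo w) (T.rewLo w) k i ω ≤ lcb α W (T.armLo w) (T.rewLo w) k (T.lcbArm w k ω) ω
  /-- If no source task passes the check, none is trusted. -/
  task_none : ∀ k, A < k → ∀ ω, T.passing α ε k ω = ∅ → T.task k ω = none
  /-- A trusted task is kept as long as it passes the check. -/
  task_keep : ∀ k, A < k → ∀ ω, T.CanKeep α ε k ω → T.task k ω = T.task (k - 1) ω
  /-- When the trusted task fails, a passing task recommending the previous action is preferred. -/
  task_inherit : ∀ k, A < k → ∀ ω, ¬ T.CanKeep α ε k ω → T.task (k - 1) ω ≠ none →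
    (∃ w, T.Inherits α ε k ω w) → ∃ w, T.Inherits α ε k ω w ∧ T.task k ω = some w
  /-- Otherwise the trusted task is drawn uniformly from `I^k`. -/
  task_resample : ∀ k, A < k → ∀ ω, T.Resamples α ε k ω →
    ∃ w ∈ T.passing α ε k ω, T.task k ω = some w
  task_uniform : ∀ k, A < k → ∀ w, ∀ᵐ ω ∂P, T.Resamples α ε k ω → w ∈ T.passing α ε k ω →
    (P⟦{ω' | T.task k ω' = some w}|
      T.history k ⊔ ⨆ v, MeasurableSpace.comap (T.lcbArm v k) ⊤⟧) ω =
        1 / ((T.passing α ε k ω).card : ℝ)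
  /-- If a task is trusted, its lower-confidence arm is pulled in the high-tier task. -/
  armHi_trust : ∀ k, A < k → ∀ ω w, T.task k ω = some w → T.armHi k ω = T.lcbArm w k ω
  /-- If no task is trusted, the high-tier task is played by UCB. -/
  armHi_ucb : ∀ k, A < k → ∀ ω, T.task k ω = none → ∀ i,
    ucb α W T.armHi T.rewHi k i ω ≤ ucb α W T.armHi T.rewHi k (T.armHi k ω) ω

/-- The pseudo-regret `E[∑_{k=1}^K (max_i μ_Hi(i) - μ_Hi(π_Hi^k))]` in the high-tier task. -/
def regretHi [MeasurableSpace Ω] (T : TieredTrace A W Ω) (P : Measure Ω) (Hi : BanditTask A)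
    (K : ℕ) : ℝ :=
  ∫ ω, ∑ k ∈ Finset.Icc 1 K, (Hi.optValue - Hi.mean (T.armHi k ω)) ∂P

end TieredTrace

/-- `∑_{i : Δ(i) > 0} 1 / Δ(i)`. -/
def BanditTask.invGapSum {A : ℕ} (M : BanditTask A) : ℝ :=
  ∑ i ∈ Finset.univ.filter (fun i => 0 < M.gap i), 1 / M.gap i

end

/-! ### Concentration of empirical means under adaptive sampling. -/

section Concentration

variable {A : ℕ} {Ω : Type*}

/-! Call a round accurate if every confidence interval of every task contains the true mean. An
exponential supermartingale and a union bound (`IsPlay.measure_not_accurate_le`) show that some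
round in the window `k / 8, …, k` is inaccurate with probability at most `8 / k ^ 2`. Gaps are at
most `1`, so these failures cost at most `16` in total regret, and everything else is a
deterministic argument on paths whose recent rounds are accurate.

On such paths a suboptimal high-tier pull always means a short pull history: `N * Δ ^ 2 ≤ 3200 * α *
log f(k)` (`IsTrustRun.pullCount_mul_sq_gap_le`). For a UCB pull this is the usual optimism
argument. For a trusted pull, the recommended arm fills more than half of the source's rounds, so it
is nearly optimal there; optimal value dominance and the passed check then make its high-tier mean
nearly optimal too, up to `3 / 4` of its own gap plus confidence widths (`IsTrustRun.gap_trust_le`).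
Summing over arms gives the bound in `log (W * K)`.

With a close source, suboptimal pulls stop altogether once `k` exceeds a polynomial in `A * W /
Δ_min` (`IsTrustRun.isOptimal_armHi`). By then every source recommends its own optimal arm
throughout `k / 2, …, k`, and the close source always passes the check, so some source is always
trusted. Suboptimal pulls are too few to fill the window, so the optimal arm is pulled at least
once, and the keep and inherit rules preserve it from then on. Hence `log f(k)` matters only up to
this threshold, where it is of order `log (A * W / Δ_min)`. Both bounds come from
`IsTrustRun.regretHi_le`, with different caps on `log f(k)`. -/

lemma HasCondLaw.map_restrict {m mΩ : MeasurableSpace Ω} {P : Measure Ω}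
    [IsProbabilityMeasure P] (hm : m ≤ mΩ) {arm : Ω → Fin A}
    (harm : Measurable[m] arm) {X : Ω → ℝ} (hX : Measurable X) {law : Fin A → Measure ℝ}
    (hlaw : ∀ i, IsProbabilityMeasure (law i)) (h : HasCondLaw P m X fun ω => law (arm ω))
    (i : Fin A) {s : Set Ω} (hs : MeasurableSet[m] s) :
    (P.restrict (s ∩ arm ⁻¹' {i})).map X = P (s ∩ arm ⁻¹' {i}) • law i := by
  have hG : MeasurableSet[m] (s ∩ arm ⁻¹' {i}) := hs.inter (harm (measurableSet_singleton i))
  ext B hB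
  have hint : Integrable ((X ⁻¹' B).indicator fun _ => (1 : ℝ)) P :=
    (integrable_const 1).indicator (hX hB)
  have h1 := setIntegral_condExp hm hint hG
  have h2 : ∫ ω in s ∩ arm ⁻¹' {i}, (P⟦X ⁻¹' B|m⟧) ω ∂P
      = ∫ ω in s ∩ arm ⁻¹' {i}, (law i).real B ∂P := by
    refine setIntegral_congr_ae (hm _ hG) ?_
    filter_upwards [h B hB] with ω hω hmem
    have : arm ω = i := hmem.2
    rw [hω, this]
  rw [h2, integral_indicator (hX hB)] at h1
  simp only [integral_const, smul_eq_mul, mul_one, measureReal_restrict_apply_univ] at h1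
  rw [measureReal_restrict_apply (hX hB)] at h1
  rw [Measure.map_apply hX hB, Measure.restrict_apply (hX hB), Measure.smul_apply, smul_eq_mul,
    ← ENNReal.toReal_eq_toReal_iff' (measure_ne_top _ _)
      (ENNReal.mul_ne_top (measure_ne_top _ _) (measure_ne_top _ _)), ENNReal.toReal_mul]
  exact h1.symm

/-- On the event that arm `i` is chosen, the new reward is independent of the past `m`. This
factorisation drives the supermartingale step; it extends `map_restrict` from indicators to
nonnegative functions. -/
lemma HasCondLaw.setLIntegral_mul {m mΩ : MeasurableSpace Ω} {P : Measure Ω}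
    [IsProbabilityMeasure P] (hm : m ≤ mΩ) {arm : Ω → Fin A}
    (harm : Measurable[m] arm) {X : Ω → ℝ} (hX : Measurable X) {law : Fin A → Measure ℝ}
    (hlaw : ∀ i, IsProbabilityMeasure (law i)) (h : HasCondLaw P m X fun ω => law (arm ω))
    (i : Fin A) {g : ℝ → ENNReal} (hg : Measurable g) {Y : Ω → ENNReal} (hY : Measurable[m] Y) :
    ∫⁻ ω in arm ⁻¹' {i}, Y ω * g (X ω) ∂P
      = (∫⁻ ω in arm ⁻¹' {i}, Y ω ∂P) * ∫⁻ x, g x ∂(law i) := by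
  have hgX : Measurable fun ω => g (X ω) := hg.comp hX
  refine Measurable.ennreal_induction (motive := fun Y => ∫⁻ ω in arm ⁻¹' {i}, Y ω * g (X ω) ∂P
      = (∫⁻ ω in arm ⁻¹' {i}, Y ω ∂P) * ∫⁻ x, g x ∂(law i)) (fun c s hs => ?_)
    (fun f g' _ hf hg' ihf ihg => ?_) (fun f hf hmono ih => ?_) hY
  · have e1 : (fun ω => s.indicator (fun _ => c) ω * g (X ω))
        = s.indicator fun ω => c * g (X ω) := by
      ext ω; by_cases hω : ω ∈ s <;> simp [hω]
    rw [e1, lintegral_indicator (hm _ hs), lintegral_indicator (hm _ hs),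
      Measure.restrict_restrict (hm _ hs), lintegral_const_mul _ hgX,
      ← lintegral_map hg hX, HasCondLaw.map_restrict hm harm hX hlaw h i hs,
      lintegral_smul_measure]
    simp [mul_assoc]
  · simp only [Pi.add_apply, add_mul]
    have hfg : Measurable fun ω => f ω * g (X ω) := (hf.mono hm le_rfl).mul hgX
    rw [lintegral_add_left hfg, lintegral_add_left (hf.mono hm le_rfl), ihf, ihg, add_mul]
  · simp only [ENNReal.iSup_mul]
    have hfg : ∀ n, Measurable fun ω => f n ω * g (X ω) := fun n =>
      ((hf n).mono hm le_rfl).mul hgX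
    have hmono' : Monotone fun n ω => f n ω * g (X ω) := fun a b hab ω =>
      mul_le_mul_left (hmono hab ω) _
    rw [lintegral_iSup (fun n => (hf n).mono hm le_rfl) hmono, lintegral_iSup hfg hmono',
      ENNReal.iSup_mul]
    exact iSup_congr ih

lemma BanditTask.mean_mem_Icc (M : BanditTask A) (i : Fin A) : M.mean i ∈ Set.Icc (0 : ℝ) 1 := by
  have := M.isProb i
  have hint : Integrable (fun x : ℝ => x) (M.law i) :=
    Integrable.of_mem_Icc 0 1 aemeasurable_id (M.mem_Icc i)
  constructor
  · exact integral_nonneg_of_ae ((M.mem_Icc i).mono fun x hx => hx.1)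
  · have := integral_mono_ae hint (integrable_const (1 : ℝ)) ((M.mem_Icc i).mono fun x hx => hx.2)
    simpa [BanditTask.mean] using this

/-- Hoeffding's lemma would allow `t ^ 2 / 8`; the weaker `t ^ 2 / 2` suffices for the chosen
confidence width. -/
lemma BanditTask.lintegral_exp_le (M : BanditTask A) (i : Fin A) (t : ℝ) :
    ∫⁻ x, ENNReal.ofReal (Real.exp (t * (x - M.mean i) - t ^ 2 / 2)) ∂(M.law i) ≤ 1 := by
  have := M.isProb i
  have hs := hasSubgaussianMGF_of_mem_Icc (μ := M.law i) (X := fun x => x) aemeasurable_id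
    (M.mem_Icc i)
  have h1 : ∫ x, Real.exp (t * (x - M.mean i)) ∂(M.law i) ≤ Real.exp (t ^ 2 / 2) := by
    refine (hs.mgf_le t).trans (Real.exp_le_exp.2 ?_)
    norm_num
    nlinarith [sq_nonneg t]
  have h2 : Integrable (fun x => Real.exp (t * (x - M.mean i))) (M.law i) := hs.integrable_exp_mul t
  simp only [Real.exp_sub]
  rw [← ofReal_integral_eq_lintegral_ofReal (h2.div_const _) (ae_of_all _ fun x => by positivity),
    integral_div]
  exact ENNReal.ofReal_le_one.2 ((div_le_one (Real.exp_pos _)).2 h1)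

/-- The centred sum of the rewards of arm `i` over the rounds `1, …, k - 1`. -/
noncomputable def centredSum (arm : ℕ → Ω → Fin A) (rew : ℕ → Ω → ℝ) (c : ℝ) (k : ℕ)
    (i : Fin A) (ω : Ω) : ℝ :=
  ∑ j ∈ (Finset.Ico 1 k).filter (fun j => arm j ω = i), (rew j ω - c)

lemma centredSum_succ (arm : ℕ → Ω → Fin A) (rew : ℕ → Ω → ℝ) (c : ℝ) {k : ℕ} (hk : 1 ≤ k)
    (i : Fin A) (ω : Ω) :
    centredSum arm rew c (k + 1) i ω
      = centredSum arm rew c k i ω + if arm k ω = i then rew k ω - c else 0 := by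
  simp only [centredSum, Finset.sum_filter]
  rw [Finset.sum_Ico_succ_top hk]

lemma pullCount_succ (arm : ℕ → Ω → Fin A) {k : ℕ} (hk : 1 ≤ k) (i : Fin A) (ω : Ω) :
    pullCount arm (k + 1) i ω = pullCount arm k i ω + if arm k ω = i then 1 else 0 := by
  simp only [pullCount, Finset.card_filter]
  rw [Finset.sum_Ico_succ_top hk]

lemma measurable_pullCount {m : MeasurableSpace Ω} {arm : ℕ → Ω → Fin A} {k : ℕ}
    (h : ∀ j ∈ Finset.Ico 1 k, Measurable[m] (arm j)) (i : Fin A) :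
    Measurable[m] fun ω => (pullCount arm k i ω : ℝ) := by
  simp only [pullCount, Finset.card_filter, Nat.cast_sum]
  refine Finset.measurable_sum _ fun j hj => ?_
  have : MeasurableSet[m] {ω | arm j ω = i} := h j hj (measurableSet_singleton i)
  exact measurable_from_top.comp (Measurable.ite this measurable_const measurable_const :
    Measurable[m] fun ω => (if arm j ω = i then (1 : ℕ) else 0))

lemma measurable_centredSum {m : MeasurableSpace Ω} {arm : ℕ → Ω → Fin A} {rew : ℕ → Ω → ℝ} {k : ℕ}
    (h : ∀ j ∈ Finset.Ico 1 k, Measurable[m] (arm j))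
    (h' : ∀ j ∈ Finset.Ico 1 k, Measurable[m] (rew j)) (c : ℝ) (i : Fin A) :
    Measurable[m] fun ω => centredSum arm rew c k i ω := by
  simp only [centredSum, Finset.sum_filter]
  refine Finset.measurable_sum _ fun j hj => ?_
  exact Measurable.ite (h j hj (measurableSet_singleton i)) ((h' j hj).sub_const c)
    measurable_const

variable {M : BanditTask A} {arm : ℕ → Ω → Fin A} {rew : ℕ → Ω → ℝ}

/-- In round `k` the empirical mean of every pulled arm is within its confidence width of the
mean. -/
def Accurate (α : ℝ) (W : ℕ) (M : BanditTask A) (arm : ℕ → Ω → Fin A) (rew : ℕ → Ω → ℝ) (k : ℕ)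
    (ω : Ω) : Prop :=
  ∀ i, 1 ≤ pullCount arm k i ω → |empMean arm rew k i ω - M.mean i| ≤ confWidth α W arm k i ω

lemma pullCount_le (arm : ℕ → Ω → Fin A) (k : ℕ) (i : Fin A) (ω : Ω) :
    pullCount arm k i ω ≤ k - 1 := by
  simpa [pullCount] using Finset.card_filter_le (Finset.Ico 1 k) fun j => arm j ω = i

lemma one_le_confFn (A W k : ℕ) : 1 ≤ confFn A W k := by
  unfold confFn; exact le_add_of_nonneg_right (by positivity)

/-- The best tilt depends on the random pull count. Letting `n` run over all possible counts
replaces it by finitely many deterministic tilts; at the true count, with `t` equal to plus or minus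
the width, the exponent is at least `t ^ 2 * n / 2 = α * log f(k)`. -/
lemma exists_deviation_of_not_accurate {α : ℝ} (hα : 0 ≤ α) {W k : ℕ} {ω : Ω}
    (h : ¬ Accurate α W M arm rew k ω) :
    ∃ i, ∃ n ∈ Finset.range k, ∃ s ∈ ({1, -1} : Finset ℝ), α * Real.log (confFn A W k)
      ≤ (s * √(2 * α * Real.log (confFn A W k) / n)) * centredSum arm rew (M.mean i) k i ω
        - (s * √(2 * α * Real.log (confFn A W k) / n)) ^ 2 / 2 * pullCount arm k i ω := by
  simp only [Accurate, not_forall, not_le] at h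
  obtain ⟨i, hi, hlt⟩ := h
  have hlog : 0 ≤ 2 * α * Real.log (confFn A W k) :=
    mul_nonneg (by positivity) (Real.log_nonneg (one_le_confFn A W k))
  set n := pullCount arm k i ω with hn
  have hn0 : (0 : ℝ) < n := by exact_mod_cast hi
  set w := √(2 * α * Real.log (confFn A W k) / n) with hw
  have hw0 : 0 ≤ w := Real.sqrt_nonneg _
  have hw2 : w ^ 2 * n = 2 * α * Real.log (confFn A W k) := by
    rw [hw, Real.sq_sqrt (by positivity)]; field_simp
  have hS : centredSum arm rew (M.mean i) k i ω = (empMean arm rew k i ω - M.mean i) * n := by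
    have : (pullCount arm k i ω : ℝ) ≠ 0 := by rw [← hn]; exact hn0.ne'
    rw [centredSum, Finset.sum_sub_distrib, empMean, hn]
    simp only [Finset.sum_const, nsmul_eq_mul]
    rw [sub_mul, div_mul_cancel₀ _ this, pullCount]
    ring
  have hwid : confWidth α W arm k i ω = w := rfl
  rw [hwid] at hlt
  refine ⟨i, n, Finset.mem_range.2 ?_, ?_⟩
  · have := pullCount_le arm k i ω
    omega
  rw [hS, ← hn]
  rcases lt_abs.1 hlt with h1 | h1
  · refine ⟨1, by simp, ?_⟩
    have : w * n * w ≤ w * n * (empMean arm rew k i ω - M.mean i) := by gcongr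
    nlinarith
  · refine ⟨-1, by simp, ?_⟩
    have : w * n * w ≤ w * n * -(empMean arm rew k i ω - M.mean i) := by gcongr
    nlinarith

/-- `arm` and `rew` record the arms and rewards of a player of `M`, where `F k` is the information
available when the reward of round `k` is drawn. -/
structure IsPlay {mΩ : MeasurableSpace Ω} (P : Measure Ω) (M : BanditTask A) (arm : ℕ → Ω → Fin A)
    (rew : ℕ → Ω → ℝ) (F : ℕ → MeasurableSpace Ω) : Prop where
  le : ∀ k, F k ≤ mΩ
  measurable_arm : ∀ k, 1 ≤ k → ∀ j, 1 ≤ j → j ≤ k → Measurable[F k] (arm j)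
  measurable_rew : ∀ k, 1 ≤ k → ∀ j, 1 ≤ j → j < k → Measurable[F k] (rew j)
  measurable_rew' : ∀ k, Measurable (rew k)
  law : ∀ k, 1 ≤ k → HasCondLaw P (F k) (rew k) fun ω => M.law (arm k ω)

variable [mΩ : MeasurableSpace Ω] {P : Measure Ω} [IsProbabilityMeasure P]
  {F : ℕ → MeasurableSpace Ω}

/-- The exponential is a supermartingale: it changes only when arm `i` is pulled, and then it gains
a factor of conditional mean at most `1`. -/
lemma IsPlay.lintegral_exp_le (h : IsPlay P M arm rew F) (t : ℝ) (i : Fin A) {k : ℕ} (hk : 1 ≤ k) :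
    ∫⁻ ω, ENNReal.ofReal (Real.exp (t * centredSum arm rew (M.mean i) k i ω
      - t ^ 2 / 2 * pullCount arm k i ω)) ∂P ≤ 1 := by
  induction k, hk using Nat.le_induction with
  | base => simp [centredSum, pullCount]
  | succ k hk ih =>
    refine le_trans ?_ ih
    set Z : Ω → ENNReal := fun ω => ENNReal.ofReal (Real.exp (t * centredSum arm rew (M.mean i) k i ω
      - t ^ 2 / 2 * pullCount arm k i ω)) with hZ
    have hZm : Measurable[F k] Z := by
      have h1 := measurable_centredSum (m := F k) (arm := arm) (rew := rew) (k := k)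
        (fun j hj => h.measurable_arm k hk j (Finset.mem_Ico.1 hj).1 (Finset.mem_Ico.1 hj).2.le)
        (fun j hj => h.measurable_rew k hk j (Finset.mem_Ico.1 hj).1 (Finset.mem_Ico.1 hj).2)
        (M.mean i) i
      have h2 := measurable_pullCount (m := F k) (arm := arm) (k := k)
        (fun j hj => h.measurable_arm k hk j (Finset.mem_Ico.1 hj).1 (Finset.mem_Ico.1 hj).2.le) i
      exact ENNReal.measurable_ofReal.comp
        (Real.measurable_exp.comp ((h1.const_mul t).sub (h2.const_mul _)))
    have hS : MeasurableSet (arm k ⁻¹' {i}) :=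
      h.le k _ (h.measurable_arm k hk k hk le_rfl (measurableSet_singleton i))
    rw [← lintegral_add_compl _ hS, ← lintegral_add_compl Z hS]
    refine add_le_add ?_ (le_of_eq ?_)
    · have e : ∀ ω ∈ arm k ⁻¹' {i}, ENNReal.ofReal (Real.exp (t * centredSum arm rew (M.mean i)
          (k + 1) i ω - t ^ 2 / 2 * pullCount arm (k + 1) i ω))
          = Z ω * (fun x => ENNReal.ofReal (Real.exp (t * (x - M.mean i) - t ^ 2 / 2)))
            (rew k ω) := by
        intro ω hω
        have hω' : arm k ω = i := hω
        rw [hZ, centredSum_succ _ _ _ hk, pullCount_succ _ hk, if_pos hω', if_pos hω']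
        dsimp only
        rw [← ENNReal.ofReal_mul (Real.exp_nonneg _), ← Real.exp_add]
        congr 2
        push_cast
        ring
      rw [setLIntegral_congr_fun hS e, HasCondLaw.setLIntegral_mul (h.le k)
        (h.measurable_arm k hk k hk le_rfl) (h.measurable_rew' k) M.isProb (h.law k hk) i
        (g := fun x => ENNReal.ofReal (Real.exp (t * (x - M.mean i) - t ^ 2 / 2))) (by fun_prop) hZm]
      exact mul_le_of_le_one_right' (M.lintegral_exp_le i t)
    · refine setLIntegral_congr_fun hS.compl fun ω hω => ?_
      have hω' : ¬ arm k ω = i := hω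
      rw [hZ, centredSum_succ _ _ _ hk, pullCount_succ _ hk, if_neg hω', if_neg hω']
      simp

/-- Markov's inequality for the exponential supermartingale. -/
lemma IsPlay.measure_le (h : IsPlay P M arm rew F) (i : Fin A) {k : ℕ} (hk : 1 ≤ k) {t : ℝ} {x : ℝ}
    {s : Set Ω} (hs : ∀ ω ∈ s, x ≤ t * centredSum arm rew (M.mean i) k i ω
      - t ^ 2 / 2 * pullCount arm k i ω) :
    P s ≤ ENNReal.ofReal (Real.exp (-x)) := by
  have h1 : ∫⁻ ω, ENNReal.ofReal (Real.exp x) * ENNReal.ofReal (Real.exp (-x)) ∂P = 1 := by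
    rw [← ENNReal.ofReal_mul (Real.exp_nonneg _), ← Real.exp_add]; simp
  have hpos : ENNReal.ofReal (Real.exp x) ≠ 0 := by simp [Real.exp_pos]
  have h2 : ENNReal.ofReal (Real.exp x) * P s ≤ 1 := by
    refine le_trans ?_ ((mul_meas_ge_le_lintegral₀ (μ := P) ?_ (ENNReal.ofReal (Real.exp x))).trans
      (h.lintegral_exp_le t i hk))
    · gcongr
      intro ω hω
      exact ENNReal.ofReal_le_ofReal (Real.exp_le_exp.2 (hs ω hω))
    · have h1 := measurable_centredSum (m := mΩ) (arm := arm) (rew := rew) (k := k)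
        (fun j hj => (h.measurable_arm k hk j (Finset.mem_Ico.1 hj).1
          (Finset.mem_Ico.1 hj).2.le).mono (h.le k) le_rfl)
        (fun j hj => h.measurable_rew' j) (M.mean i) i
      have h2 := measurable_pullCount (m := mΩ) (arm := arm) (k := k)
        (fun j hj => (h.measurable_arm k hk j (Finset.mem_Ico.1 hj).1
          (Finset.mem_Ico.1 hj).2.le).mono (h.le k) le_rfl) i
      exact (ENNReal.measurable_ofReal.comp
        (Real.measurable_exp.comp ((h1.const_mul t).sub (h2.const_mul _)))).aemeasurable
  rw [Real.exp_neg, ENNReal.ofReal_inv_of_pos (Real.exp_pos _)]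
  rwa [← ENNReal.mul_le_mul_iff_right hpos ENNReal.ofReal_ne_top,
    ENNReal.mul_inv_cancel hpos ENNReal.ofReal_ne_top]

lemma IsPlay.measure_not_accurate_le (h : IsPlay P M arm rew F) {α : ℝ} (hα : 0 ≤ α) (W : ℕ) {k : ℕ}
    (hk : 1 ≤ k) :
    P {ω | ¬ Accurate α W M arm rew k ω}
      ≤ ENNReal.ofReal (2 * A * k * Real.exp (-(α * Real.log (confFn A W k)))) := by
  set b : Fin A → ℕ → ℝ → Set Ω := fun i n s => {ω | α * Real.log (confFn A W k)
      ≤ (s * √(2 * α * Real.log (confFn A W k) / n)) * centredSum arm rew (M.mean i) k i ω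
        - (s * √(2 * α * Real.log (confFn A W k) / n)) ^ 2 / 2 * pullCount arm k i ω}
  have hsub : {ω | ¬ Accurate α W M arm rew k ω}
      ⊆ ⋃ i ∈ (Finset.univ : Finset (Fin A)), ⋃ n ∈ Finset.range k,
        ⋃ s ∈ ({1, -1} : Finset ℝ), b i n s := by
    intro ω hω
    obtain ⟨i, n, hn, s, hs, hle⟩ := exists_deviation_of_not_accurate hα hω
    simp only [Set.mem_iUnion]
    exact ⟨i, Finset.mem_univ i, n, hn, s, hs, hle⟩
  have hcard : ({1, -1} : Finset ℝ).card = 2 := by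
    rw [Finset.card_pair]; norm_num
  calc P {ω | ¬ Accurate α W M arm rew k ω}
      ≤ ∑ _i : Fin A, ∑ _n ∈ Finset.range k, ∑ _s ∈ ({1, -1} : Finset ℝ),
          ENNReal.ofReal (Real.exp (-(α * Real.log (confFn A W k)))) := by
        refine (measure_mono hsub).trans ((measure_biUnion_finset_le _ _).trans ?_)
        refine Finset.sum_le_sum fun i _ => (measure_biUnion_finset_le _ _).trans ?_
        refine Finset.sum_le_sum fun n _ => (measure_biUnion_finset_le _ _).trans ?_
        exact Finset.sum_le_sum fun s _ => h.measure_le i hk fun ω hω => hω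
    _ = _ := by
        simp only [Finset.sum_const, hcard, Finset.card_range, Finset.card_univ, Fintype.card_fin,
          nsmul_eq_mul]
        rw [ENNReal.ofReal_mul (by positivity), ENNReal.ofReal_mul (by positivity),
          ENNReal.ofReal_mul (by positivity)]
        simp only [ENNReal.ofReal_natCast, ENNReal.ofReal_ofNat, Nat.cast_ofNat]
        ring

end Concentration

/-! ### Optimal arms and gaps. -/

namespace BanditTask

variable {A W : ℕ} (M : BanditTask A)

lemma mean_le_optValue (i : Fin A) : M.mean i ≤ M.optValue :=
  le_ciSup (Set.finite_range M.mean).bddAbove i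

lemma gap_nonneg (i : Fin A) : 0 ≤ M.gap i := sub_nonneg.2 (M.mean_le_optValue i)

variable {M}

lemma IsOptimal.mean_eq {i : Fin A} (h : M.IsOptimal i) : M.mean i = M.optValue :=
  have : Nonempty (Fin A) := ⟨i⟩
  le_antisymm (M.mean_le_optValue i) (ciSup_le h)

lemma IsOptimal.gap_eq_zero {i : Fin A} (h : M.IsOptimal i) : M.gap i = 0 := by
  rw [gap, h.mean_eq, sub_self]

lemma gap_pos_iff {i : Fin A} : 0 < M.gap i ↔ ¬ M.IsOptimal i := by
  refine ⟨fun h h' => h.ne' h'.gap_eq_zero, fun h => (M.gap_nonneg i).lt_of_ne' fun h0 => h ?_⟩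
  intro j
  have := M.mean_le_optValue j
  rw [gap] at h0
  linarith

lemma gap_le_one (i : Fin A) : M.gap i ≤ 1 := by
  have : Nonempty (Fin A) := ⟨i⟩
  have h : M.optValue ≤ 1 := ciSup_le fun j => (M.mean_mem_Icc j).2
  have := (M.mean_mem_Icc i).1
  rw [gap]; linarith

lemma minGap_le {i : Fin A} (h : ¬ M.IsOptimal i) : M.minGap ≤ M.gap i :=
  ciInf_le (Set.finite_range fun i : {i : Fin A // ¬ M.IsOptimal i} => M.gap i).bddBelow ⟨i, h⟩

lemma exists_not_isOptimal (hA : 2 ≤ A) (h : ∃! i, M.IsOptimal i) : ∃ i, ¬ M.IsOptimal i := by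
  have : Nontrivial (Fin A) := Fin.nontrivial_iff_two_le.2 hA
  obtain ⟨i, -, hu⟩ := h
  obtain ⟨j, hj⟩ := exists_ne i
  exact ⟨j, fun h' => hj (hu j h')⟩

lemma minGap_pos (hA : 2 ≤ A) (h : ∃! i, M.IsOptimal i) : 0 < M.minGap := by
  obtain ⟨j, hj⟩ := exists_not_isOptimal hA h
  have : Nonempty {i : Fin A // ¬ M.IsOptimal i} := ⟨⟨j, hj⟩⟩
  obtain ⟨i, hi⟩ := exists_eq_ciInf_of_finite (f := fun i : {i : Fin A // ¬ M.IsOptimal i} => M.gap i)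
  rw [minGap, ← hi]
  exact gap_pos_iff.2 i.2

lemma jointMinGap_pos {Hi : BanditTask A} {Lo : Fin W → BanditTask A} (hA : 2 ≤ A) (hW : 2 ≤ W)
    (hHi : ∃! i, Hi.IsOptimal i) (hLo : ∀ w, ∃! i, (Lo w).IsOptimal i) :
    0 < jointMinGap Hi Lo := by
  have : Nonempty (Fin W) := ⟨⟨0, by omega⟩⟩
  obtain ⟨w, hw⟩ := exists_eq_ciInf_of_finite (f := fun w => (Lo w).minGap)
  rw [jointMinGap, ← hw]
  exact lt_min (minGap_pos hA hHi) (minGap_pos hA (hLo w))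

lemma jointMinGap_le_hi {Hi : BanditTask A} {Lo : Fin W → BanditTask A} {i : Fin A}
    (h : ¬ Hi.IsOptimal i) : jointMinGap Hi Lo ≤ Hi.gap i :=
  (min_le_left _ _).trans (minGap_le h)

lemma jointMinGap_le_lo {Hi : BanditTask A} {Lo : Fin W → BanditTask A} {w : Fin W} {i : Fin A}
    (h : ¬ (Lo w).IsOptimal i) : jointMinGap Hi Lo ≤ (Lo w).gap i :=
  (min_le_right _ _).trans ((ciInf_le (Set.finite_range fun w => (Lo w).minGap).bddBelow w).trans
    (minGap_le h))

end BanditTask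

/-! ### Pathwise analysis of pull counts and of UCB. -/

section Path

variable {A W : ℕ} {Ω : Type*} {arm : ℕ → Ω → Fin A} {rew : ℕ → Ω → ℝ} {ω : Ω}

lemma pullCount_mono (arm : ℕ → Ω → Fin A) {k k' : ℕ} (h : k ≤ k') (i : Fin A) (ω : Ω) :
    pullCount arm k i ω ≤ pullCount arm k' i ω :=
  Finset.card_le_card (Finset.filter_subset_filter _ (Finset.Ico_subset_Ico_right h))

lemma sum_pullCount (arm : ℕ → Ω → Fin A) (k : ℕ) (ω : Ω) :
    ∑ i, pullCount arm k i ω = k - 1 := by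
  rw [← Nat.card_Ico 1 k]
  exact (Finset.card_eq_sum_card_fiberwise (f := fun j => arm j ω) (t := Finset.univ)
    fun _ _ => Finset.mem_univ _).symm

lemma pullCount_lt_of_lt {j k : ℕ} {a : Fin A} (hj : 1 ≤ j) (hjk : j < k) (ha : arm j ω = a) :
    pullCount arm j a ω < pullCount arm k a ω := by
  have h1 := pullCount_succ arm hj a ω
  rw [if_pos ha] at h1
  have h2 := pullCount_mono arm (Nat.succ_le_of_lt hjk) a ω
  rw [Nat.succ_eq_add_one] at h2
  omega

lemma exists_last_pull {k : ℕ} {a : Fin A} (h : 1 ≤ pullCount arm k a ω) :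
    ∃ j, 1 ≤ j ∧ j < k ∧ arm j ω = a ∧ pullCount arm k a ω = pullCount arm j a ω + 1 := by
  induction k with
  | zero => simp [pullCount] at h
  | succ k ih =>
    rcases Nat.eq_zero_or_pos k with rfl | hk
    · simp [pullCount] at h
    have h1 := pullCount_succ arm hk a ω
    by_cases ha : arm k ω = a
    · exact ⟨k, hk, Nat.lt_succ_self k, ha, by rw [h1, if_pos ha]⟩
    · rw [if_neg ha, add_zero] at h1
      obtain ⟨j, hj1, hjk, hja, hj⟩ := ih (h1 ▸ h)
      exact ⟨j, hj1, hjk.trans (Nat.lt_succ_self k), hja, h1.trans hj⟩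

lemma one_le_pullCount (hinit : ∀ i, ∃ k ∈ Finset.Icc 1 A, arm k ω = i) {k : ℕ} (hk : A < k)
    (i : Fin A) : 1 ≤ pullCount arm k i ω := by
  obtain ⟨j, hj, hji⟩ := hinit i
  rw [Finset.mem_Icc] at hj
  exact Finset.card_pos.2 ⟨j, Finset.mem_filter.2 ⟨Finset.mem_Ico.2 ⟨hj.1, by omega⟩, hji⟩⟩

/-- The `A` initial rounds cover all `A` arms, so by counting each arm occurs exactly once. -/
lemma pullCount_eq_zero (hinit : ∀ i, ∃ k ∈ Finset.Icc 1 A, arm k ω = i) {k : ℕ} (hk : 1 ≤ k)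
    (hkA : k ≤ A) : pullCount arm k (arm k ω) ω = 0 := by
  have h1 : ∀ i ∈ Finset.univ, 1 ≤ pullCount arm (A + 1) i ω := fun i _ =>
    one_le_pullCount hinit (Nat.lt_succ_self A) i
  have h2 : ∑ _i : Fin A, 1 = ∑ i, pullCount arm (A + 1) i ω := by
    rw [sum_pullCount]; simp
  have h3 := (Finset.sum_eq_sum_iff_of_le h1).1 h2 (arm k ω) (Finset.mem_univ _)
  have := pullCount_lt_of_lt (arm := arm) (ω := ω) hk (Nat.lt_succ_of_le hkA) rfl
  rw [Nat.succ_eq_add_one] at this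
  omega

/-- The pull count increases strictly along the pulls of `a`, so these rounds inject into the
integers from `0` to `⌊m⌋`. -/
lemma card_pulls_le {S : Finset ℕ} {a : Fin A} {m : ℝ} (hm : 0 ≤ m)
    (hS : ∀ k ∈ S, 1 ≤ k ∧ arm k ω = a ∧ (pullCount arm k a ω : ℝ) ≤ m) : (S.card : ℝ) ≤ m + 1 := by
  have h1 : S.card ≤ (Finset.range (⌊m⌋₊ + 1)).card := by
    refine Finset.card_le_card_of_injOn (fun k => pullCount arm k a ω) (fun k hk => ?_) ?_
    · simpa using Nat.lt_succ_of_le (Nat.le_floor (hS k hk).2.2)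
    · intro j hj k hk hjk
      dsimp only at hjk
      rcases lt_trichotomy j k with h | h | h
      · exact absurd hjk (pullCount_lt_of_lt (hS j hj).1 h (hS j hj).2.1).ne
      · exact h
      · exact absurd hjk (pullCount_lt_of_lt (hS k hk).1 h (hS k hk).2.1).ne'
  rw [Finset.card_range] at h1
  calc (S.card : ℝ) ≤ ((⌊m⌋₊ + 1 : ℕ) : ℝ) := by exact_mod_cast h1
    _ ≤ m + 1 := by push_cast; gcongr; exact Nat.floor_le hm

lemma card_suboptimal_le {M : BanditTask A} {D c : ℝ} (hD : 0 < D)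
    (hgap : ∀ a, ¬ M.IsOptimal a → D ≤ M.gap a) (hc : 0 ≤ c) {S : Finset ℕ}
    (hS : ∀ k ∈ S, 1 ≤ k ∧ ¬ M.IsOptimal (arm k ω) ∧
      pullCount arm k (arm k ω) ω * M.gap (arm k ω) ^ 2 ≤ c) :
    (S.card : ℝ) ≤ A * (c / D ^ 2 + 1) := by
  rw [Finset.card_eq_sum_card_fiberwise (f := fun k => arm k ω) (t := Finset.univ)
    fun _ _ => Finset.mem_univ _, Nat.cast_sum]
  refine (Finset.sum_le_sum fun a _ => card_pulls_le (arm := arm) (ω := ω) (a := a)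
    (m := c / D ^ 2) (by positivity) fun k hk => ?_).trans_eq (by simp [mul_add])
  obtain ⟨hkS, rfl⟩ := Finset.mem_filter.1 hk
  obtain ⟨h1, h2, h3⟩ := hS k hkS
  refine ⟨h1, rfl, (le_div_iff₀ (by positivity)).2 (le_trans ?_ h3)⟩
  gcongr
  exact hgap _ h2

lemma confFn_mono (A W : ℕ) {j k : ℕ} (h : j ≤ k) : confFn A W j ≤ confFn A W k := by
  unfold confFn; gcongr

lemma log_confFn_nonneg (A W k : ℕ) : 0 ≤ Real.log (confFn A W k) :=
  Real.log_nonneg (one_le_confFn A W k)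

lemma log_confFn_mono (A W : ℕ) {j k : ℕ} (h : j ≤ k) :
    Real.log (confFn A W j) ≤ Real.log (confFn A W k) :=
  Real.log_le_log (zero_lt_one.trans_le (one_le_confFn A W j)) (confFn_mono A W h)

variable {M : BanditTask A} {α : ℝ}

lemma confWidth_le (hα : 0 ≤ α) {j k : ℕ} (hjk : j ≤ k) {a : Fin A} {c : ℝ} (hc : 0 < c)
    (h : c ≤ pullCount arm j a ω) :
    confWidth α W arm j a ω ≤ √(2 * α * Real.log (confFn A W k) / c) := by
  have h0 := log_confFn_nonneg A W k
  have h1 : 0 ≤ 2 * α * Real.log (confFn A W k) := by positivity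
  have h2 := log_confFn_mono A W hjk
  unfold confWidth
  gcongr

lemma confWidth_nonneg (k : ℕ) (a : Fin A) : 0 ≤ confWidth α W arm k a ω := Real.sqrt_nonneg _

lemma Accurate.mean_le_ucb {k : ℕ} (h : Accurate α W M arm rew k ω) {a : Fin A}
    (ha : 1 ≤ pullCount arm k a ω) : M.mean a ≤ ucb α W arm rew k a ω := by
  have := abs_le.1 (h a ha); rw [ucb]; linarith

lemma Accurate.ucb_le {k : ℕ} (h : Accurate α W M arm rew k ω) {a : Fin A}
    (ha : 1 ≤ pullCount arm k a ω) :
    ucb α W arm rew k a ω ≤ M.mean a + 2 * confWidth α W arm k a ω := by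
  have := abs_le.1 (h a ha); rw [ucb]; linarith

lemma Accurate.lcb_le_mean {k : ℕ} (h : Accurate α W M arm rew k ω) {a : Fin A}
    (ha : 1 ≤ pullCount arm k a ω) : lcb α W arm rew k a ω ≤ M.mean a := by
  have := abs_le.1 (h a ha); rw [lcb]; linarith

lemma Accurate.le_lcb {k : ℕ} (h : Accurate α W M arm rew k ω) {a : Fin A}
    (ha : 1 ≤ pullCount arm k a ω) :
    M.mean a - 2 * confWidth α W arm k a ω ≤ lcb α W arm rew k a ω := by
  have := abs_le.1 (h a ha); rw [lcb]; linarith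

lemma gap_le_of_ucb (hopt : ∃ i, M.IsOptimal i)
    (hinit : ∀ i, ∃ k ∈ Finset.Icc 1 A, arm k ω = i) {k : ℕ} (hk : A < k)
    (hacc : Accurate α W M arm rew k ω)
    (hucb : ∀ i, ucb α W arm rew k i ω ≤ ucb α W arm rew k (arm k ω) ω) :
    M.gap (arm k ω) ≤ 2 * confWidth α W arm k (arm k ω) ω := by
  obtain ⟨i, hi⟩ := hopt
  have h1 := hacc.mean_le_ucb (one_le_pullCount hinit hk i)
  have h2 := hacc.ucb_le (one_le_pullCount hinit hk (arm k ω))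
  have h3 := hucb i
  rw [BanditTask.gap, ← hi.mean_eq]
  linarith

/-- Squaring turns a gap below a multiple of the width into a logarithmic cap on the number of
pulls. -/
lemma mul_sq_le_of_le_confWidth (hα : 0 ≤ α) {k : ℕ} {a : Fin A} {g c : ℝ} (hg : 0 ≤ g)
    (hN : 1 ≤ pullCount arm k a ω) (h : g ≤ c * confWidth α W arm k a ω) :
    pullCount arm k a ω * g ^ 2 ≤ 2 * c ^ 2 * α * Real.log (confFn A W k) := by
  have hN' : (0 : ℝ) < pullCount arm k a ω := by exact_mod_cast hN
  have hL := log_confFn_nonneg A W k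
  have h2 : g ^ 2 ≤ (c * confWidth α W arm k a ω) ^ 2 := by gcongr
  calc pullCount arm k a ω * g ^ 2 ≤ pullCount arm k a ω * (c * confWidth α W arm k a ω) ^ 2 := by
        gcongr
    _ = 2 * c ^ 2 * α * Real.log (confFn A W k) := by
        rw [mul_pow, confWidth, Real.sq_sqrt (by positivity)]
        field_simp

/-- An arm that UCB has pulled in more than half of the rounds has a small gap. -/
lemma gap_le_of_half_lt_pullCount (hα : 0 ≤ α) (hA : 2 ≤ A) (hopt : ∃ i, M.IsOptimal i)
    (hinit : ∀ i, ∃ k ∈ Finset.Icc 1 A, arm k ω = i)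
    (hucb : ∀ k, A < k → ∀ i, ucb α W arm rew k i ω ≤ ucb α W arm rew k (arm k ω) ω)
    {k : ℕ} (hk : A < k) (hacc : ∀ j, k ≤ 2 * j → j ≤ k → Accurate α W M arm rew j ω) {a : Fin A}
    (ha : (k : ℝ) / 2 < pullCount arm k a ω) :
    M.gap a ≤ 2 * √(8 * α * Real.log (confFn A W k) / k) := by
  have ha' : k < 2 * pullCount arm k a ω := by
    have : (k : ℝ) < 2 * pullCount arm k a ω := by linarith
    exact_mod_cast this
  -- UCB optimism is applied at the last pull of `a`. That round lies in the second half, since at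
  -- least `k / 2` rounds are needed for that many pulls, and `a` already has at least `k / 4` pulls
  -- there.
  obtain ⟨j, hj1, hjk, rfl, hj⟩ := exists_last_pull (arm := arm) (k := k) (a := a) (ω := ω) (by omega)
  have hjN := pullCount_le arm j (arm j ω) ω
  have hjA : A < j := by
    by_contra hcon
    have := pullCount_eq_zero hinit hj1 (not_lt.1 hcon)
    omega
  have hk0 : (0 : ℝ) < k := by exact_mod_cast (by omega : 0 < k)
  have h4 : (k : ℝ) / 4 ≤ pullCount arm j (arm j ω) ω := by
    have : k ≤ 4 * pullCount arm j (arm j ω) ω := by omega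
    have : (k : ℝ) ≤ 4 * pullCount arm j (arm j ω) ω := by exact_mod_cast this
    linarith
  refine (gap_le_of_ucb hopt hinit hjA (hacc j (by omega) hjk.le) (hucb j hjA)).trans ?_
  gcongr
  refine (confWidth_le hα hjk.le (by positivity) h4).trans_eq ?_
  congr 1
  field_simp
  ring

/-- After a long run of accurate rounds, UCB has pulled the optimal arm in most rounds. -/
lemma half_lt_pullCount_optimal (hα : 0 ≤ α) {D : ℝ} (hD : 0 < D)
    (hgap : ∀ a, ¬ M.IsOptimal a → D ≤ M.gap a) {b : Fin A} (hb : M.IsOptimal b)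
    (huniq : ∀ a, M.IsOptimal a → a = b)
    (hinit : ∀ i, ∃ k ∈ Finset.Icc 1 A, arm k ω = i)
    (hucb : ∀ k, A < k → ∀ i, ucb α W arm rew k i ω ≤ ucb α W arm rew k (arm k ω) ω)
    {k : ℕ} (hacc : ∀ j, k ≤ 8 * j → j ≤ k → Accurate α W M arm rew j ω)
    (hQ : A * (3200 * α * Real.log (confFn A W k) / D ^ 2 + 1) + 1 < (k : ℝ) / 8)
    {j : ℕ} (hj : k ≤ 2 * j) (hjk : j ≤ k) : (j : ℝ) / 2 < pullCount arm j b ω := by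
  have hL := log_confFn_nonneg A W k
  have hX : 0 ≤ 3200 * α * Real.log (confFn A W k) / D ^ 2 := by positivity
  have hA0 : (0 : ℝ) ≤ A := A.cast_nonneg
  have hkA : ∀ t : ℕ, k ≤ 8 * t → A < t := fun t ht => by
    have h1 : (k : ℝ) ≤ 8 * t := by exact_mod_cast ht
    have h2 : (A : ℝ) < t := by nlinarith
    exact_mod_cast h2
  set S := (Finset.Ico 1 j).filter fun t => ¬ arm t ω = b
  have hS : pullCount arm j b ω + S.card = j - 1 := by
    rw [← Nat.card_Ico 1 j]
    exact Finset.card_filter_add_card_filter_not _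
  -- Pulls of other arms before round `j`: at most `k / 8` fall before `k / 8`, where accuracy is
  -- unknown, and fewer than `k / 8 - 1` after it. This leaves more than `j - k / 4 ≥ j / 2` pulls
  -- of `b`.
  have hS' : S.card = (S.filter fun t => k ≤ 8 * t).card + (S.filter fun t => ¬ k ≤ 8 * t).card :=
    (Finset.card_filter_add_card_filter_not _).symm
  have h1 : ((S.filter fun t => ¬ k ≤ 8 * t).card : ℝ) ≤ k / 8 := by
    have h : (S.filter fun t => ¬ k ≤ 8 * t).card ≤ (Finset.Icc 1 (k / 8)).card := by
      refine Finset.card_le_card fun t ht => ?_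
      simp only [S, Finset.mem_filter, Finset.mem_Ico] at ht
      rw [Finset.mem_Icc]
      omega
    rw [Nat.card_Icc, Nat.add_sub_cancel] at h
    exact (Nat.cast_le.2 h).trans Nat.cast_div_le
  have h2 : ((S.filter fun t => k ≤ 8 * t).card : ℝ)
      ≤ A * (3200 * α * Real.log (confFn A W k) / D ^ 2 + 1) := by
    refine card_suboptimal_le (arm := arm) (ω := ω) hD hgap (by positivity) fun t ht => ?_
    simp only [S, Finset.mem_filter, Finset.mem_Ico] at ht
    obtain ⟨⟨⟨ht1, htj⟩, htb⟩, htk⟩ := ht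
    have htA := hkA t htk
    refine ⟨ht1, fun h => htb (huniq _ h), ?_⟩
    refine (mul_sq_le_of_le_confWidth hα (M.gap_nonneg _) (one_le_pullCount hinit htA _)
      (gap_le_of_ucb ⟨b, hb⟩ hinit htA (hacc t htk (htj.le.trans hjk)) (hucb t htA))).trans ?_
    have h3 := log_confFn_mono A W (htj.le.trans hjk)
    have h4 := log_confFn_nonneg A W t
    calc 2 * 2 ^ 2 * α * Real.log (confFn A W t) ≤ 3200 * α * Real.log (confFn A W t) := by
          gcongr; norm_num
      _ ≤ _ := by gcongr
  have hj1 : 1 ≤ j := by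
    have : (0 : ℝ) < k := by nlinarith
    have : 0 < k := by exact_mod_cast this
    omega
  have hS2 : (pullCount arm j b ω : ℝ) + ((S.filter fun t => k ≤ 8 * t).card
      + (S.filter fun t => ¬ k ≤ 8 * t).card) = j - 1 := by
    rw [hS'] at hS
    have : pullCount arm j b ω + ((S.filter fun t => k ≤ 8 * t).card
      + (S.filter fun t => ¬ k ≤ 8 * t).card) + 1 = j := by omega
    have : (pullCount arm j b ω : ℝ) + ((S.filter fun t => k ≤ 8 * t).card
      + (S.filter fun t => ¬ k ≤ 8 * t).card) + 1 = j := by exact_mod_cast this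
    linarith
  have hj' : (k : ℝ) ≤ 2 * j := by exact_mod_cast hj
  linarith

/-- After a long run of accurate rounds, the arm with the largest lower confidence bound is
optimal. -/
lemma isOptimal_of_lcb (hα : 0 ≤ α) {D : ℝ} (hD : 0 < D)
    (hgap : ∀ a, ¬ M.IsOptimal a → D ≤ M.gap a) {b : Fin A} (hb : M.IsOptimal b)
    (hinit : ∀ i, ∃ k ∈ Finset.Icc 1 A, arm k ω = i) {k : ℕ}
    (hQ : A * (3200 * α * Real.log (confFn A W k) / D ^ 2 + 1) + 1 < (k : ℝ) / 8)
    {j : ℕ} (hj : k ≤ 2 * j) (hjk : j ≤ k) (hacc : Accurate α W M arm rew j ω)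
    (hhalf : (j : ℝ) / 2 < pullCount arm j b ω) {a : Fin A}
    (ha : ∀ i, lcb α W arm rew j i ω ≤ lcb α W arm rew j a ω) : M.IsOptimal a := by
  by_contra hna
  have hL := log_confFn_nonneg A W k
  have hX : 0 ≤ 3200 * α * Real.log (confFn A W k) / D ^ 2 := by positivity
  have hA1 : (1 : ℝ) ≤ A := by exact_mod_cast Fin.pos a
  have hj' : (k : ℝ) ≤ 2 * j := by exact_mod_cast hj
  have hk0 : (0 : ℝ) < k := by nlinarith
  have hjA : A < j := by
    have h2 : (A : ℝ) < j := by nlinarith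
    exact_mod_cast h2
  have h1 := hacc.lcb_le_mean (one_le_pullCount hinit hjA a)
  have h2 := hacc.le_lcb (one_le_pullCount hinit hjA b)
  have h3 := ha b
  have h4 := hgap a hna
  rw [BanditTask.gap, ← hb.mean_eq] at h4
  -- `b` has more than `j / 2 ≥ k / 4` pulls, so twice its width is below `D`, and its lower bound
  -- exceeds the mean of any suboptimal arm.
  have h5 : confWidth α W arm j b ω ≤ √(2 * α * Real.log (confFn A W k) / (k / 4)) :=
    confWidth_le hα hjk (by positivity) (by linarith)
  have h6 : √(2 * α * Real.log (confFn A W k) / (k / 4)) < D / 2 := by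
    rw [Real.sqrt_lt' (by positivity), div_lt_iff₀ (by positivity)]
    have h7 : 3200 * α * Real.log (confFn A W k) / D ^ 2 < k / 8 := by nlinarith
    rw [div_lt_iff₀ (by positivity)] at h7
    nlinarith [mul_nonneg hα hL]
  linarith

end Path

/-! ### Pathwise analysis of the trust rule. -/

namespace TieredTrace

variable {A W : ℕ} {Ω : Type*}

/-- In round `k` all confidence intervals of all tasks are correct. -/
def AllAccurate (T : TieredTrace A W Ω) (α : ℝ) (Hi : BanditTask A) (Lo : Fin W → BanditTask A)
    (k : ℕ) (ω : Ω) : Prop :=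
  Accurate α W Hi T.armHi T.rewHi k ω ∧ ∀ w, Accurate α W (Lo w) (T.armLo w) (T.rewLo w) k ω

/-- All confidence intervals are correct in the rounds `k / 8, …, k`. -/
def RecentlyAccurate (T : TieredTrace A W Ω) (α : ℝ) (Hi : BanditTask A) (Lo : Fin W → BanditTask A)
    (k : ℕ) (ω : Ω) : Prop :=
  ∀ j, k ≤ 8 * j → j ≤ k → T.AllAccurate α Hi Lo j ω

variable [MeasurableSpace Ω] {P : Measure Ω} {T : TieredTrace A W Ω} {α ε Δt : ℝ}
  {Hi : BanditTask A} {Lo : Fin W → BanditTask A} {k : ℕ} {ω : Ω}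

lemma IsTrustRun.exists_task (h : T.IsTrustRun P α ε Hi Lo) (hk : A < k)
    (hne : (T.passing α ε k ω).Nonempty) : ∃ w ∈ T.passing α ε k ω, T.task k ω = some w := by
  by_cases hkeep : T.CanKeep α ε k ω
  · obtain ⟨w, hw, hprev⟩ := id hkeep
    exact ⟨w, hw, (h.task_keep k hk ω hkeep).trans hprev⟩
  by_cases hinh : T.task (k - 1) ω ≠ none ∧ ∃ w, T.Inherits α ε k ω w
  · obtain ⟨w, hw, htask⟩ := h.task_inherit k hk ω hkeep hinh.1 hinh.2
    exact ⟨w, hw.1, htask⟩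
  · exact h.task_resample k hk ω ⟨hne, hkeep, hinh⟩

lemma IsTrustRun.mem_passing (h : T.IsTrustRun P α ε Hi Lo) (hk : A < k) {w : Fin W}
    (hw : T.task k ω = some w) : w ∈ T.passing α ε k ω := by
  rcases (T.passing α ε k ω).eq_empty_or_nonempty with he | hne
  · rw [h.task_none k hk ω he] at hw
    exact absurd hw (by simp)
  · obtain ⟨v, hv, htask⟩ := h.exists_task hk hne
    rw [hw, Option.some_inj] at htask
    exact htask ▸ hv

/-- Being recommended in over half the rounds makes the arm nearly optimal in the source; dominance
and the passed check transfer this to the high tier. The slacks `Δ_min / 2` and `Δt / 4` total at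
most `3 / 4` of the gap, and the remaining quarter is at most `10` high-tier widths. -/
lemma IsTrustRun.gap_trust_le (h : T.IsTrustRun P α (Δt / 4) Hi Lo) (hα : 0 ≤ α) (hA : 2 ≤ A)
    (hLo : ∀ w, ∃ i, (Lo w).IsOptimal i)
    (hdom : ∀ w, Hi.optValue - BanditTask.jointMinGap Hi Lo / 2 ≤ (Lo w).optValue)
    (hΔ : Δt ≤ BanditTask.jointMinGap Hi Lo) (hk : A < k)
    (hacc : ∀ j, k ≤ 2 * j → j ≤ k → T.AllAccurate α Hi Lo j ω) {w : Fin W}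
    (hw : T.task k ω = some w) :
    Hi.gap (T.armHi k ω) ≤ 40 * confWidth α W T.armHi k (T.armHi k ω) ω := by
  by_cases hopt : Hi.IsOptimal (T.armHi k ω)
  · rw [hopt.gap_eq_zero]
    exact mul_nonneg (by norm_num) (confWidth_nonneg _ _)
  have hpass := h.mem_passing hk hw
  rw [passing, Finset.mem_filter, ← h.armHi_trust k hk ω w hw] at hpass
  obtain ⟨-, hle, hcount⟩ := hpass
  set a := T.armHi k ω
  have hk0 : (0 : ℝ) < k := by exact_mod_cast (by omega : 0 < k)
  have hL := log_confFn_nonneg A W k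
  have hNHi := one_le_pullCount (h.init_armHi ω) hk a
  have hNLo := one_le_pullCount (h.init_armLo w ω) hk a
  have hN0 : (0 : ℝ) < pullCount T.armHi k a ω := by exact_mod_cast hNHi
  have haccHi := (hacc k (by omega) le_rfl).1
  have haccLo := (hacc k (by omega) le_rfl).2 w
  have h1 := gap_le_of_half_lt_pullCount hα hA (hLo w) (h.init_armLo w ω)
    (fun k hk => h.armLo_ucb w k hk ω) hk (fun j hj hjk => (hacc j hj hjk).2 w) hcount
  have h2 : confWidth α W (T.armLo w) k a ω ≤ √(8 * α * Real.log (confFn A W k) / k) := by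
    refine (confWidth_le hα le_rfl (c := k / 4) (by positivity) (by linarith)).trans_eq ?_
    congr 1
    field_simp
    ring
  have h3 : √(8 * α * Real.log (confFn A W k) / k) ≤ 2 * confWidth α W T.armHi k a ω := by
    -- The source arm has order `k` pulls and the high-tier arm at most `k`, so the high-tier width
    -- dominates the source error.
    have hNk : (pullCount T.armHi k a ω : ℝ) ≤ k := by
      exact_mod_cast (pullCount_le T.armHi k a ω).trans (Nat.sub_le k 1)
    refine Real.sqrt_le_iff.2 ⟨mul_nonneg (by norm_num) (confWidth_nonneg _ _), ?_⟩
    rw [mul_pow, confWidth, Real.sq_sqrt (by positivity), mul_div_assoc',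
      show 2 ^ 2 * (2 * α * Real.log (confFn A W k)) = 8 * α * Real.log (confFn A W k) by ring]
    gcongr
  have h4 := haccHi.ucb_le hNHi
  have h5 := haccLo.le_lcb hNLo
  have h6 := hdom w
  have h7 := BanditTask.jointMinGap_le_hi (Lo := Lo) hopt
  rw [BanditTask.gap] at h1 h7 ⊢
  linarith

/-- In accurate rounds, a suboptimal high-tier arm has been pulled only logarithmically often. -/
lemma IsTrustRun.pullCount_mul_sq_gap_le (h : T.IsTrustRun P α (Δt / 4) Hi Lo) (hα : 0 ≤ α)
    (hA : 2 ≤ A) (hHi : ∃ i, Hi.IsOptimal i) (hLo : ∀ w, ∃ i, (Lo w).IsOptimal i)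
    (hdom : ∀ w, Hi.optValue - BanditTask.jointMinGap Hi Lo / 2 ≤ (Lo w).optValue)
    (hΔ : Δt ≤ BanditTask.jointMinGap Hi Lo) (hk : A < k)
    (hacc : ∀ j, k ≤ 2 * j → j ≤ k → T.AllAccurate α Hi Lo j ω) :
    pullCount T.armHi k (T.armHi k ω) ω * Hi.gap (T.armHi k ω) ^ 2
      ≤ 3200 * α * Real.log (confFn A W k) := by
  have hN := one_le_pullCount (h.init_armHi ω) hk (T.armHi k ω)
  have hgap : Hi.gap (T.armHi k ω) ≤ 40 * confWidth α W T.armHi k (T.armHi k ω) ω := by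
    cases htask : T.task k ω with
    | some w => exact h.gap_trust_le hα hA hLo hdom hΔ hk hacc htask
    | none =>
      have h1 := gap_le_of_ucb hHi (h.init_armHi ω) hk (hacc k (by omega) le_rfl).1
        (h.armHi_ucb k hk ω htask)
      have h2 : 0 ≤ confWidth α W T.armHi k (T.armHi k ω) ω := confWidth_nonneg _ _
      linarith
  exact (mul_sq_le_of_le_confWidth hα (Hi.gap_nonneg _) hN hgap).trans_eq (by ring)

/-- With a close source task, the high-tier player has locked onto the optimal arm after a long run
of accurate rounds. -/
lemma IsTrustRun.isOptimal_armHi (h : T.IsTrustRun P α (Δt / 4) Hi Lo) (hα : 0 ≤ α)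
    (hA : 2 ≤ A) (hD : 0 < BanditTask.jointMinGap Hi Lo)
    (hHi : ∃! i, Hi.IsOptimal i) (hLo : ∀ w, ∃! i, (Lo w).IsOptimal i)
    (hdom : ∀ w, Hi.optValue - BanditTask.jointMinGap Hi Lo / 2 ≤ (Lo w).optValue)
    (hΔ : Δt ≤ BanditTask.jointMinGap Hi Lo)
    (hclose : ∃ w, BanditTask.IsClose (Δt / 4) Hi (Lo w))
    (hacc : T.RecentlyAccurate α Hi Lo k ω)
    (hQ : A * (3200 * α * Real.log (confFn A W k) / BanditTask.jointMinGap Hi Lo ^ 2 + 1) + 1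
      < (k : ℝ) / 8) :
    Hi.IsOptimal (T.armHi k ω) := by
  set D := BanditTask.jointMinGap Hi Lo
  obtain ⟨c, hc⟩ := hclose
  obtain ⟨b, hb, hbu⟩ := id hHi
  choose bLo hbLo hbLou using hLo
  have hbc : bLo c = b := hbu _ ((hc.2 _).2 (hbLo c))
  have hL := log_confFn_nonneg A W k
  have hX : 0 ≤ 3200 * α * Real.log (confFn A W k) / D ^ 2 := by positivity
  have hA2 : (2 : ℝ) ≤ A := by exact_mod_cast hA
  have hAj : ∀ j : ℕ, k ≤ 2 * j → A < j := fun j hj => by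
    have h1 : (k : ℝ) ≤ 2 * j := by exact_mod_cast hj
    have h2 : (A : ℝ) < j := by nlinarith
    exact_mod_cast h2
  have hhalf : ∀ w j, k ≤ 2 * j → j ≤ k → (j : ℝ) / 2 < pullCount (T.armLo w) j (bLo w) ω :=
    fun w j hj hjk => half_lt_pullCount_optimal (M := Lo w) hα hD
      (fun a ha => BanditTask.jointMinGap_le_lo ha) (hbLo w) (hbLou w) (h.init_armLo w ω)
      (fun k hk => h.armLo_ucb w k hk ω) (fun j hj hjk => (hacc j hj hjk).2 w) hQ hj hjk
  have hlcb : ∀ w j, k ≤ 2 * j → j ≤ k → T.lcbArm w j ω = bLo w := fun w j hj hjk =>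
    hbLou w _ (isOptimal_of_lcb (M := Lo w) hα hD (fun a ha => BanditTask.jointMinGap_le_lo ha)
      (hbLo w) (h.init_armLo w ω) hQ hj hjk ((hacc j (by omega) hjk).2 w) (hhalf w j hj hjk)
      (h.lcbArm_lcb w j (hAj j hj) ω))
  have hmost : ∀ w j, k ≤ 2 * j → j ≤ k → ∀ i, i ≠ bLo w →
      pullCount (T.armLo w) j i ω < pullCount (T.armLo w) j (bLo w) ω := by
    intro w j hj hjk i hi
    have h1 : (j : ℝ) < 2 * pullCount (T.armLo w) j (bLo w) ω := by
      have := hhalf w j hj hjk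
      linarith
    have h2 : j < 2 * pullCount (T.armLo w) j (bLo w) ω := by exact_mod_cast h1
    have h3 : ∑ a ∈ ({i, bLo w} : Finset (Fin A)), pullCount (T.armLo w) j a ω ≤ j - 1 := by
      rw [← sum_pullCount (T.armLo w) j ω]
      exact Finset.sum_le_sum_of_subset (Finset.subset_univ _)
    rw [Finset.sum_pair hi] at h3
    omega
  -- The close source shares the optimal arm `b`, and its value exceeds the high-tier one by at most
  -- `Δt / 4`, exactly the tolerance of the check.
  have hpass : ∀ j, k ≤ 2 * j → j ≤ k → c ∈ T.passing α (Δt / 4) j ω := by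
    intro j hj hjk
    have hac := hacc j (by omega) hjk
    refine Finset.mem_filter.2 ⟨Finset.mem_univ _, ?_, ?_⟩
    · rw [hlcb c j hj hjk, hbc]
      have h1 := (hac.2 c).lcb_le_mean (one_le_pullCount (h.init_armLo c ω) (hAj j hj) b)
      have h2 := hac.1.mean_le_ucb (one_le_pullCount (h.init_armHi ω) (hAj j hj) b)
      have h3 := hc.1
      have h4 := (hbLo c).mean_eq
      rw [hbc] at h4
      rw [hb.mean_eq] at h2
      linarith
    · rw [hlcb c j hj hjk]
      exact hhalf c j hj hjk
  have htask : ∀ j, k ≤ 2 * j → j ≤ k → ∃ w ∈ T.passing α (Δt / 4) j ω, T.task j ω = some w :=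
    fun j hj hjk => h.exists_task (hAj j hj) ⟨c, hpass j hj hjk⟩
  -- Otherwise all of the roughly `k / 2` rounds of the window would be suboptimal pulls, more than
  -- `hQ` allows.
  have hstart : ∃ j, k ≤ 2 * j ∧ j ≤ k ∧ Hi.IsOptimal (T.armHi j ω) := by
    by_contra! hcon
    have hcard := card_suboptimal_le (arm := T.armHi) (ω := ω) (M := Hi) (D := D)
      (c := 3200 * α * Real.log (confFn A W k)) (S := (Finset.Icc 1 k).filter fun j => k ≤ 2 * j)
      hD (fun a ha => BanditTask.jointMinGap_le_hi ha) (by positivity) fun j hj => by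
        simp only [Finset.mem_filter, Finset.mem_Icc] at hj
        obtain ⟨⟨hj1, hjk⟩, hj⟩ := hj
        refine ⟨hj1, hcon j hj hjk, ?_⟩
        refine (h.pullCount_mul_sq_gap_le hα hA hHi.exists (fun w => ⟨bLo w, hbLo w⟩) hdom hΔ
          (hAj j hj) fun t ht htj => hacc t (by omega) (htj.trans hjk)).trans ?_
        have := log_confFn_mono A W hjk
        gcongr
    have h1 : k - k / 2 - 1 ≤ ((Finset.Icc 1 k).filter fun j => k ≤ 2 * j).card := by
      refine le_trans ?_ (Finset.card_le_card (s := Finset.Icc (k / 2 + 1) k) fun j hj => ?_)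
      · rw [Nat.card_Icc]; omega
      · rw [Finset.mem_Icc] at hj
        simp only [Finset.mem_filter, Finset.mem_Icc]
        omega
    have h2 : k ≤ 2 * (((Finset.Icc 1 k).filter fun j => k ≤ 2 * j).card + 1) := by omega
    have h3 : (k : ℝ) ≤ 2 * (((Finset.Icc 1 k).filter fun j => k ≤ 2 * j).card + 1) := by
      exact_mod_cast h2
    linarith
  obtain ⟨j, hj, hjk, hjopt⟩ := hstart
  have hstep : ∀ n, j ≤ n → n ≤ k → Hi.IsOptimal (T.armHi n ω) := by
    intro n hjn
    induction n, hjn using Nat.le_induction with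
    | base => exact fun _ => hjopt
    | succ n hjn ih =>
      intro hnk
      have hn : k ≤ 2 * n := by omega
      have hn' : k ≤ 2 * (n + 1) := by omega
      have hnb : T.armHi n ω = b := hbu _ (ih (by omega))
      obtain ⟨v, -, hv⟩ := htask n hn (by omega)
      by_cases hkeep : T.CanKeep α (Δt / 4) (n + 1) ω
      · have hnext := h.task_keep (n + 1) (hAj _ hn') ω hkeep
        rw [Nat.add_sub_cancel, hv] at hnext
        have h1 := h.armHi_trust n (hAj n hn) ω v hv
        have h2 := h.armHi_trust (n + 1) (hAj _ hn') ω v hnext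
        rw [hlcb v n hn (by omega), hnb] at h1
        rw [h2, hlcb v (n + 1) hn' hnk, ← h1]
        exact hb
      · obtain ⟨w, hw, hnext⟩ := h.task_inherit (n + 1) (hAj _ hn') ω hkeep
          (by rw [Nat.add_sub_cancel, hv]; simp) ⟨c, hpass _ hn' hnk, fun i => by
            rw [Nat.add_sub_cancel, hnb, ← hbc]
            rcases eq_or_ne i (bLo c) with rfl | hi
            · exact le_rfl
            · exact (hmost c (n + 1) hn' hnk i hi).le⟩
        have h1 := hw.2 (bLo w)
        rw [Nat.add_sub_cancel, hnb] at h1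
        have h2 : b = bLo w := by
          by_contra hne
          exact absurd (hmost w (n + 1) hn' hnk b hne) (not_lt.2 h1)
        rw [h.armHi_trust (n + 1) (hAj _ hn') ω w hnext, hlcb w (n + 1) hn' hnk, ← h2]
        exact hb
  exact hstep k hjk le_rfl

end TieredTrace

/-! ### Size of the confidence function, failure probabilities and the generic regret bound. -/

lemma log_confFn_le {A W k : ℕ} (hW : 2 ≤ W) (hk : A < k) :
    Real.log (confFn A W k) ≤ 11 * Real.log ((W : ℝ) * k) := by
  have hk1 : (1 : ℝ) ≤ k := by exact_mod_cast (by omega : 1 ≤ k)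
  have hW2 : (2 : ℝ) ≤ W := by exact_mod_cast hW
  have hAk : (A : ℝ) ≤ k := by exact_mod_cast hk.le
  have hWk : (2 : ℝ) ≤ W * k := by nlinarith
  have h1 : confFn A W k ≤ 1 + 16 * W * k ^ 2 * (2 * k) ^ 2 := by
    unfold confFn
    gcongr
    linarith
  have h2 : 1 + 16 * W * k ^ 2 * (2 * k) ^ 2 ≤ 65 * ((W : ℝ) * k) ^ 4 := by
    have h3 : (1 : ℝ) ≤ ((W : ℝ) * k) ^ 4 := one_le_pow₀ (by linarith)
    have h4 : (W : ℝ) ≤ W ^ 4 := le_self_pow₀ (by linarith) (by norm_num)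
    have h5 : W * (k : ℝ) ^ 4 ≤ W ^ 4 * k ^ 4 := by gcongr
    rw [← mul_pow] at h5
    nlinarith
  -- `W * k ≥ 2` and `2 ^ 7 ≥ 65`, whence the exponent `11 = 7 + 4`.
  have h3 : 65 * ((W : ℝ) * k) ^ 4 ≤ ((W : ℝ) * k) ^ 11 := by
    have : (2 : ℝ) ^ 7 ≤ ((W : ℝ) * k) ^ 7 := by gcongr
    calc 65 * ((W : ℝ) * k) ^ 4 ≤ ((W : ℝ) * k) ^ 7 * ((W : ℝ) * k) ^ 4 := by
          gcongr; linarith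
      _ = _ := by ring
  have := Real.log_le_log (zero_lt_one.trans_le (one_le_confFn A W k)) (h1.trans (h2.trans h3))
  rwa [Real.log_pow] at this

lemma sum_inv_sq_le_two (K : ℕ) : ∑ k ∈ Finset.Icc 1 K, 1 / (k : ℝ) ^ 2 ≤ 2 := by
  have := sum_Ioo_inv_sq_le (α := ℝ) 0 (K + 1)
  simp only [one_div]
  refine le_trans (le_of_eq ?_) (this.trans_eq (by norm_num))
  congr 1

namespace TieredTrace

variable {A W : ℕ} {Ω : Type*}

lemma info_le_history (T : TieredTrace A W Ω) {j k : ℕ} (hj : 1 ≤ j) (hjk : j < k) :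
    T.decisionInfo j ⊔ T.rewardInfo j ≤ T.history k :=
  le_iSup₂ (f := fun j (_ : j ∈ Finset.Ico 1 k) => T.decisionInfo j ⊔ T.rewardInfo j) j
    (Finset.mem_Ico.2 ⟨hj, hjk⟩)

lemma decisionInfo_le_info (T : TieredTrace A W Ω) {j k : ℕ} (hj : 1 ≤ j) (hjk : j ≤ k) :
    T.decisionInfo j ≤ T.history k ⊔ T.decisionInfo k := by
  rcases hjk.eq_or_lt with rfl | hlt
  · exact le_sup_right
  · exact (le_sup_left.trans (T.info_le_history hj hlt)).trans le_sup_left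

lemma rewardInfo_le_info (T : TieredTrace A W Ω) {j k : ℕ} (hj : 1 ≤ j) (hjk : j < k) :
    T.rewardInfo j ≤ T.history k ⊔ T.decisionInfo k :=
  (le_sup_right.trans (T.info_le_history hj hjk)).trans le_sup_left

variable [mΩ : MeasurableSpace Ω] {P : Measure Ω} {T : TieredTrace A W Ω}
  {α ε Δt : ℝ} {Hi : BanditTask A} {Lo : Fin W → BanditTask A}

lemma IsTrustRun.decisionInfo_le (h : T.IsTrustRun P α ε Hi Lo) (k : ℕ) : T.decisionInfo k ≤ mΩ :=
  sup_le (sup_le (sup_le (iSup_le fun w => (h.measurable_armLo w k).comap_le)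
    (iSup_le fun w => (h.measurable_lcbArm w k).comap_le)) (h.measurable_task k).comap_le)
    (h.measurable_armHi k).comap_le

lemma IsTrustRun.rewardInfo_le (h : T.IsTrustRun P α ε Hi Lo) (k : ℕ) : T.rewardInfo k ≤ mΩ :=
  sup_le (iSup_le fun w => (h.measurable_rewLo w k).comap_le) (h.measurable_rewHi k).comap_le

lemma IsTrustRun.info_le (h : T.IsTrustRun P α ε Hi Lo) (k : ℕ) :
    T.history k ⊔ T.decisionInfo k ≤ mΩ :=
  sup_le (iSup₂_le fun j _ => sup_le (h.decisionInfo_le j) (h.rewardInfo_le j))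
    (h.decisionInfo_le k)

lemma IsTrustRun.isPlay_hi (h : T.IsTrustRun P α ε Hi Lo) :
    IsPlay P Hi T.armHi T.rewHi fun k => T.history k ⊔ T.decisionInfo k where
  le := h.info_le
  measurable_arm _ _ _ hj hjk :=
    (Measurable.of_comap_le le_rfl).mono (le_sup_right.trans (T.decisionInfo_le_info hj hjk)) le_rfl
  measurable_rew _ _ _ hj hjk :=
    (Measurable.of_comap_le le_rfl).mono (le_sup_right.trans (T.rewardInfo_le_info hj hjk)) le_rfl
  measurable_rew' := h.measurable_rewHi
  law := h.law_rewHi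

lemma IsTrustRun.isPlay_lo (h : T.IsTrustRun P α ε Hi Lo) (w : Fin W) :
    IsPlay P (Lo w) (T.armLo w) (T.rewLo w) fun k => T.history k ⊔ T.decisionInfo k where
  le := h.info_le
  measurable_arm _ _ j hj hjk :=
    (Measurable.of_comap_le le_rfl).mono ((((le_iSup (fun w => MeasurableSpace.comap (T.armLo w j) ⊤)
      w).trans le_sup_left).trans (le_sup_left.trans le_sup_left)).trans
        (T.decisionInfo_le_info hj hjk)) le_rfl
  measurable_rew _ _ j hj hjk :=
    (Measurable.of_comap_le le_rfl).mono (((le_iSup (fun w => MeasurableSpace.comap (T.rewLo w j)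
      inferInstance) w).trans le_sup_left).trans (T.rewardInfo_le_info hj hjk)) le_rfl
  measurable_rew' := h.measurable_rewLo w
  law := h.law_rewLo w

variable [IsProbabilityMeasure P]

/-- Union bound over `W + 1` tasks. Since `α > 2`, each tail is at most `f(k) ^ (-2)`, and the
factor `W * A ^ 2` inside `f` absorbs the number of tasks and arms. -/
lemma IsTrustRun.measure_not_allAccurate_le (h : T.IsTrustRun P α ε Hi Lo) (hα : 2 < α) (hA : 2 ≤ A)
    (hW : 2 ≤ W) {k : ℕ} (hk : 1 ≤ k) :
    P {ω | ¬ T.AllAccurate α Hi Lo k ω} ≤ ENNReal.ofReal (1 / (64 * (k : ℝ) ^ 3)) := by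
  set q : ENNReal := ENNReal.ofReal (2 * A * k * Real.exp (-(α * Real.log (confFn A W k)))) with hq
  have hsub : {ω | ¬ T.AllAccurate α Hi Lo k ω} ⊆ {ω | ¬ Accurate α W Hi T.armHi T.rewHi k ω}
      ∪ ⋃ w ∈ (Finset.univ : Finset (Fin W)),
        {ω | ¬ Accurate α W (Lo w) (T.armLo w) (T.rewLo w) k ω} := by
    intro ω hω
    by_contra hcon
    simp only [Set.mem_union, Set.mem_iUnion, Set.mem_ofPred_eq, Finset.mem_univ, not_or, not_not,
      not_exists, true_and, exists_prop] at hcon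
    exact hω ⟨hcon.1, hcon.2⟩
  have h1 : P {ω | ¬ T.AllAccurate α Hi Lo k ω} ≤ q + ∑ _w : Fin W, q := by
    refine (measure_mono hsub).trans ((measure_union_le _ _).trans (add_le_add
      (h.isPlay_hi.measure_not_accurate_le (by linarith) W hk)
      ((measure_biUnion_finset_le _ _).trans (Finset.sum_le_sum fun w _ =>
        (h.isPlay_lo w).measure_not_accurate_le (by linarith) W hk))))
  refine h1.trans ?_
  have hk1 : (1 : ℝ) ≤ k := by exact_mod_cast hk
  have hW2 : (2 : ℝ) ≤ W := by exact_mod_cast hW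
  have hA2 : (2 : ℝ) ≤ A := by exact_mod_cast hA
  have hf : 16 * W * (A : ℝ) ^ 2 * k ^ 2 ≤ confFn A W k := by
    have : (k : ℝ) ^ 2 ≤ (k + 1) ^ 2 := by gcongr; linarith
    unfold confFn
    have h2 : 16 * W * (A : ℝ) ^ 2 * k ^ 2 ≤ 16 * W * (A : ℝ) ^ 2 * (k + 1) ^ 2 := by gcongr
    linarith
  have hf0 : (0 : ℝ) < confFn A W k := zero_lt_one.trans_le (one_le_confFn A W k)
  have hexp : Real.exp (-(α * Real.log (confFn A W k))) ≤ (confFn A W k ^ 2)⁻¹ := by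
    rw [Real.exp_neg]
    refine inv_anti₀ (by positivity) ?_
    rw [← Real.exp_log (pow_pos hf0 2), Real.log_pow]
    have := log_confFn_nonneg A W k
    gcongr
    push_cast
    nlinarith
  rw [Finset.sum_const, Finset.card_univ, Fintype.card_fin, nsmul_eq_mul, ← one_add_mul,
    show (1 + (W : ENNReal)) = ENNReal.ofReal (1 + W) by
      rw [ENNReal.ofReal_add (by norm_num) (by positivity)]; simp, hq,
    ← ENNReal.ofReal_mul (by positivity)]
  refine ENNReal.ofReal_le_ofReal ?_
  calc (1 + W) * (2 * A * k * Real.exp (-(α * Real.log (confFn A W k))))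
      ≤ (2 * W) * (2 * A * k * ((16 * W * (A : ℝ) ^ 2 * k ^ 2) ^ 2)⁻¹) := by
        gcongr
        · linarith
        · refine hexp.trans ?_
          gcongr
    _ = 1 / (64 * (k : ℝ) ^ 3) * (1 / (W * A ^ 3)) := by
        field_simp
        norm_num
    _ ≤ 1 / (64 * (k : ℝ) ^ 3) := by
        refine mul_le_of_le_one_right (by positivity) ?_
        rw [div_le_one (by positivity)]
        have : (1 : ℝ) ≤ A ^ 3 := one_le_pow₀ (by linarith)
        nlinarith

/-- The window holds at most `k` rounds, each failing with probability at most `8 / k ^ 3`. Starting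
it at a fixed fraction of `k`, rather than at round `1`, is what keeps this summable in `k`. -/
lemma IsTrustRun.measure_not_recentlyAccurate_le (h : T.IsTrustRun P α ε Hi Lo) (hα : 2 < α)
    (hA : 2 ≤ A) (hW : 2 ≤ W) {k : ℕ} (hk : 1 ≤ k) :
    P {ω | ¬ T.RecentlyAccurate α Hi Lo k ω} ≤ ENNReal.ofReal (8 * (1 / (k : ℝ) ^ 2)) := by
  have hk1 : (1 : ℝ) ≤ k := by exact_mod_cast hk
  have hsub : {ω | ¬ T.RecentlyAccurate α Hi Lo k ω}
      ⊆ ⋃ j ∈ (Finset.Icc 1 k).filter fun j => k ≤ 8 * j, {ω | ¬ T.AllAccurate α Hi Lo j ω} := by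
    intro ω hω
    simp only [Set.mem_ofPred_eq, RecentlyAccurate, not_forall] at hω
    obtain ⟨j, hj, hjk, hbad⟩ := hω
    simp only [Set.mem_iUnion]
    exact ⟨j, Finset.mem_filter.2 ⟨Finset.mem_Icc.2 ⟨by omega, hjk⟩, hj⟩, hbad⟩
  calc P {ω | ¬ T.RecentlyAccurate α Hi Lo k ω}
      ≤ ∑ _j ∈ (Finset.Icc 1 k).filter (fun j => k ≤ 8 * j), ENNReal.ofReal (8 / (k : ℝ) ^ 3) := by
        refine (measure_mono hsub).trans ((measure_biUnion_finset_le _ _).trans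
          (Finset.sum_le_sum fun j hj => ?_))
        obtain ⟨hj1, hj⟩ := Finset.mem_filter.1 hj
        refine (h.measure_not_allAccurate_le hα hA hW (Finset.mem_Icc.1 hj1).1).trans
          (ENNReal.ofReal_le_ofReal ?_)
        have hkj : (k : ℝ) / 8 ≤ j := by
          have : (k : ℝ) ≤ 8 * j := by exact_mod_cast hj
          linarith
        calc 1 / (64 * (j : ℝ) ^ 3) ≤ 1 / (64 * ((k : ℝ) / 8) ^ 3) := by gcongr
          _ = 8 / (k : ℝ) ^ 3 := by field_simp; norm_num
    _ ≤ ∑ _j ∈ Finset.Icc 1 k, ENNReal.ofReal (8 / (k : ℝ) ^ 3) :=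
        Finset.sum_le_sum_of_subset (Finset.filter_subset _ _)
    _ = _ := by
        rw [Finset.sum_const, Nat.card_Icc, Nat.add_sub_cancel, nsmul_eq_mul,
          ← ENNReal.ofReal_natCast, ← ENNReal.ofReal_mul (by positivity)]
        congr 1
        field_simp

/-- If, in accurate rounds, a suboptimal arm is only pulled while `log f(k) ≤ m`, then the regret is
of order `m ∑ 1 / Δ(i)`. -/
lemma IsTrustRun.regretHi_le (h : T.IsTrustRun P α (Δt / 4) Hi Lo) (hα : 2 < α) (hA : 2 ≤ A)
    (hW : 2 ≤ W) (hHi : ∃ i, Hi.IsOptimal i) (hLo : ∀ w, ∃ i, (Lo w).IsOptimal i)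
    (hdom : ∀ w, Hi.optValue - BanditTask.jointMinGap Hi Lo / 2 ≤ (Lo w).optValue)
    (hΔ : Δt ≤ BanditTask.jointMinGap Hi Lo) {K : ℕ} {m : ℝ} (hm : 0 ≤ m)
    (hpull : ∀ k ∈ Finset.Icc 1 K, A < k → ∀ ω, T.RecentlyAccurate α Hi Lo k ω →
      Hi.IsOptimal (T.armHi k ω) ∨ Real.log (confFn A W k) ≤ m) :
    T.regretHi P Hi K ≤ (3200 * α * m + 1) * Hi.invGapSum + 16 := by
  -- Measurable hulls have the same measure and spare a measurability proof for the failure events.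
  set B : ℕ → Set Ω := fun k => toMeasurable P {ω | ¬ T.RecentlyAccurate α Hi Lo k ω}
  have hB : ∀ k ω, ω ∉ B k → T.RecentlyAccurate α Hi Lo k ω := fun k ω hω => by
    by_contra hcon
    exact hω (subset_toMeasurable P _ hcon)
  have hBm : ∀ k, MeasurableSet (B k) := fun k => measurableSet_toMeasurable _ _
  have hBP : ∀ k, 1 ≤ k → P.real (B k) ≤ 8 * (1 / (k : ℝ) ^ 2) := fun k hk => by
    refine ENNReal.toReal_le_of_le_ofReal (by positivity) ?_
    rw [measure_toMeasurable]
    exact h.measure_not_recentlyAccurate_le hα hA hW hk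
  have hpoint : ∀ ω, ∑ k ∈ Finset.Icc 1 K, (Hi.optValue - Hi.mean (T.armHi k ω))
      ≤ (3200 * α * m + 1) * Hi.invGapSum
        + ∑ k ∈ Finset.Icc 1 K, (B k).indicator (fun _ => (1 : ℝ)) ω := by
    intro ω
    classical
    set S := (Finset.Icc 1 K).filter fun k => ω ∉ B k
    have h1 : ∑ k ∈ Finset.Icc 1 K, Hi.gap (T.armHi k ω) ≤ ∑ k ∈ S, Hi.gap (T.armHi k ω)
        + ∑ k ∈ Finset.Icc 1 K, (B k).indicator (fun _ => (1 : ℝ)) ω := by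
      rw [Finset.sum_filter, ← Finset.sum_add_distrib]
      refine Finset.sum_le_sum fun k _ => ?_
      by_cases hk : ω ∈ B k
      · simpa [hk] using BanditTask.gap_le_one (T.armHi k ω)
      · simp [hk]
    have h2 : ∑ k ∈ S, Hi.gap (T.armHi k ω) ≤ (3200 * α * m + 1) * Hi.invGapSum := by
      rw [← Finset.sum_fiberwise_of_maps_to (g := fun k => T.armHi k ω) (t := Finset.univ)
        fun _ _ => Finset.mem_univ _, BanditTask.invGapSum, Finset.mul_sum, Finset.sum_filter]
      refine Finset.sum_le_sum fun a _ => ?_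
      have e1 : ∑ k ∈ S with T.armHi k ω = a, Hi.gap (T.armHi k ω)
          = (S.filter fun k => T.armHi k ω = a).card * Hi.gap a := by
        rw [← nsmul_eq_mul, ← Finset.sum_const]
        exact Finset.sum_congr rfl fun k hk => by rw [(Finset.mem_filter.1 hk).2]
      rw [e1]
      split_ifs with hgap
      · have hcard : ((S.filter fun k => T.armHi k ω = a).card : ℝ)
            ≤ 3200 * α * m / Hi.gap a ^ 2 + 1 := by
          refine card_pulls_le (arm := T.armHi) (ω := ω) (a := a) (by positivity) fun k hk => ?_
          obtain ⟨hkS, hka⟩ := Finset.mem_filter.1 hk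
          obtain ⟨hkK, hkB⟩ := Finset.mem_filter.1 hkS
          have hk1 := (Finset.mem_Icc.1 hkK).1
          refine ⟨hk1, hka, ?_⟩
          -- In the initial rounds the pulled arm has count `0`, so accuracy is not needed.
          rcases le_or_gt k A with hkA | hkA
          · have := pullCount_eq_zero (h.init_armHi ω) hk1 hkA
            rw [hka] at this
            rw [this]
            push_cast
            positivity
          · have hrec := hB k ω hkB
            have h3 := h.pullCount_mul_sq_gap_le (by linarith) hA hHi hLo hdom hΔ hkA
              fun j hj hjk => hrec j (by omega) hjk
            have h4 : Real.log (confFn A W k) ≤ m :=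
              (hpull k hkK hkA ω hrec).resolve_left (by rw [hka]; exact BanditTask.gap_pos_iff.1 hgap)
            rw [hka] at h3
            rw [le_div_iff₀ (by positivity)]
            refine h3.trans ?_
            gcongr
        have hg1 := BanditTask.gap_le_one (M := Hi) a
        calc ((S.filter fun k => T.armHi k ω = a).card : ℝ) * Hi.gap a
            ≤ (3200 * α * m / Hi.gap a ^ 2 + 1) * Hi.gap a := by gcongr
          _ = 3200 * α * m * (1 / Hi.gap a) + Hi.gap a := by field_simp
          _ ≤ 3200 * α * m * (1 / Hi.gap a) + 1 / Hi.gap a := by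
              gcongr
              exact hg1.trans ((one_le_div hgap).2 hg1)
          _ = _ := by ring
      · rw [le_antisymm (not_lt.1 hgap) (Hi.gap_nonneg a), mul_zero]
    exact h1.trans (by gcongr)
  have hmeas : ∀ k, Measurable fun ω => Hi.optValue - Hi.mean (T.armHi k ω) := fun k =>
    (measurable_of_finite fun i => Hi.optValue - Hi.mean i).comp (h.measurable_armHi k)
  have hint : Integrable (fun ω => ∑ k ∈ Finset.Icc 1 K, (Hi.optValue - Hi.mean (T.armHi k ω))) P :=
    integrable_finsetSum _ fun k _ => Integrable.of_mem_Icc 0 1 (hmeas k).aemeasurable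
      (ae_of_all _ fun ω => ⟨Hi.gap_nonneg _, BanditTask.gap_le_one _⟩)
  have hintB : ∀ k ∈ Finset.Icc 1 K, Integrable ((B k).indicator fun _ => (1 : ℝ)) P := fun k _ =>
    (integrable_const 1).indicator (hBm k)
  calc T.regretHi P Hi K ≤ ∫ ω, ((3200 * α * m + 1) * Hi.invGapSum
        + ∑ k ∈ Finset.Icc 1 K, (B k).indicator (fun _ => (1 : ℝ)) ω) ∂P :=
        integral_mono hint ((integrable_const _).add (integrable_finsetSum _ hintB)) hpoint
    _ = (3200 * α * m + 1) * Hi.invGapSum + ∑ k ∈ Finset.Icc 1 K, P.real (B k) := by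
        rw [integral_add (integrable_const _) (integrable_finsetSum _ hintB),
          integral_finsetSum _ hintB]
        congr 1
        · simp
        · exact Finset.sum_congr rfl fun k _ => by rw [integral_indicator (hBm k)]; simp
    _ ≤ (3200 * α * m + 1) * Hi.invGapSum + ∑ k ∈ Finset.Icc 1 K, 8 * (1 / (k : ℝ) ^ 2) := by
        gcongr with k hk
        exact hBP k (Finset.mem_Icc.1 hk).1
    _ ≤ _ := by
        rw [← Finset.mul_sum]
        linarith [sum_inv_sq_le_two K]

end TieredTrace

/-! ### The threshold and the two regret bounds. -/

/-- Beyond a polynomial threshold, logarithmic exploration is a small fraction of all rounds. -/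
lemma exploration_lt {A W k : ℕ} {α D : ℝ} (hα : 2 < α) (hA : 2 ≤ A) (hW : 2 ≤ W) (hD : 0 < D)
    (hD1 : D ≤ 1) (hk : (563216 * α) ^ 2 * ((A : ℝ) * W / D) ^ 4 < k) :
    A * (3200 * α * Real.log (confFn A W k) / D ^ 2 + 1) + 1 < (k : ℝ) / 8 := by
  have hW2 : (2 : ℝ) ≤ W := by exact_mod_cast hW
  have hA2 : (2 : ℝ) ≤ A := by exact_mod_cast hA
  set x := (A : ℝ) * W / D
  have hAx : (A : ℝ) ≤ x := by
    rw [le_div_iff₀ hD]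
    nlinarith
  have hx1 : 1 ≤ x := by linarith
  set s := √(k : ℝ)
  have hs2 : s ^ 2 = k := Real.sq_sqrt (Nat.cast_nonneg k)
  have hs : 563216 * α * x ^ 2 < s := by
    refine Real.lt_sqrt_of_sq_lt ?_
    calc (563216 * α * x ^ 2) ^ 2 = (563216 * α) ^ 2 * x ^ 4 := by ring
      _ < (k : ℝ) := hk
  have hx2 : x ≤ x ^ 2 := le_self_pow₀ hx1 (by norm_num)
  have hs1 : 1 ≤ s := by nlinarith
  have hkA : A < k := by
    have : (A : ℝ) < k := by rw [← hs2]; nlinarith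
    exact_mod_cast this
  have hlog : Real.log (confFn A W k) ≤ 22 * (W * s) := by
    have hWk : (0 : ℝ) < √((W : ℝ) * k) := by
      rw [Real.sqrt_pos]
      have : (0 : ℝ) < k := by rw [← hs2]; positivity
      positivity
    have h1 : Real.log ((W : ℝ) * k) ≤ 2 * √((W : ℝ) * k) := by
      have h2 := Real.log_le_sub_one_of_pos hWk
      rw [Real.log_sqrt (by positivity)] at h2
      linarith
    have h3 : √((W : ℝ) * k) ≤ W * s := by
      rw [Real.sqrt_mul (by positivity)]
      gcongr
      exact Real.sqrt_le_iff.2 ⟨by positivity, by nlinarith⟩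
    linarith [log_confFn_le hW hkA]
  have h1 : (A : ℝ) * (3200 * α * Real.log (confFn A W k) / D ^ 2) ≤ 70400 * α * x ^ 2 * s := by
    have hAW : (A : ℝ) * W ≤ ((A : ℝ) * W) ^ 2 := le_self_pow₀ (by nlinarith) (by norm_num)
    calc (A : ℝ) * (3200 * α * Real.log (confFn A W k) / D ^ 2)
        ≤ A * (3200 * α * (22 * (W * s)) / D ^ 2) := by gcongr
      _ = 70400 * α * (A * W / D ^ 2) * s := by ring
      _ ≤ 70400 * α * (((A : ℝ) * W) ^ 2 / D ^ 2) * s := by gcongr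
      _ = _ := by rw [← div_pow]
  have h2 : (A : ℝ) + 1 ≤ 2 * α * x ^ 2 * s := by
    have : x ^ 2 * 1 ≤ x ^ 2 * s := by gcongr
    nlinarith
  -- With `563216 = 8 * (70400 + 2)`, the left side is at most `70402 * α * x ^ 2 * s < s ^ 2 / 8 =
  -- k / 8`.
  nlinarith

theorem mainTheorem6 (α : ℝ) (hα : 2 < α) :
    ∃ C : ℝ, 0 < C ∧
      ∀ (A W : ℕ), 2 ≤ A → 2 ≤ W →
      ∀ (Hi : BanditTask A) (Lo : Fin W → BanditTask A) (Δt : ℝ),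
        (∃! i, Hi.IsOptimal i) → (∀ w, ∃! i, (Lo w).IsOptimal i) →
        (∀ w, Hi.optValue - BanditTask.jointMinGap Hi Lo / 2 ≤ (Lo w).optValue) →
        0 ≤ Δt → Δt ≤ BanditTask.jointMinGap Hi Lo →
      ∀ (Ω : Type*) [MeasurableSpace Ω] (P : Measure Ω) [IsProbabilityMeasure P]
        (T : TieredTrace A W Ω), T.IsTrustRun P α (Δt / 4) Hi Lo →
        (∀ K : ℕ, 1 ≤ K →
          T.regretHi P Hi K ≤ C * (Hi.invGapSum * Real.log ((W : ℝ) * (K : ℝ)))) ∧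
        ((∃ w, BanditTask.IsClose (Δt / 4) Hi (Lo w)) →
          ∀ K : ℕ, 1 ≤ K →
            T.regretHi P Hi K ≤
              C * (Hi.invGapSum *
                Real.log ((A : ℝ) * (W : ℝ) / BanditTask.jointMinGap Hi Lo))) := by
  have hC : 0 ≤ Real.log ((563216 * α) ^ 2) := Real.log_nonneg (one_le_pow₀ (by linarith))
  refine ⟨35200 * α * (Real.log ((563216 * α) ^ 2) + 5) + 34, by positivity, ?_⟩
  intro A W hA hW Hi Lo Δt hHi hLo hdom _ hΔ Ω _ P _ T h
  have hD := BanditTask.jointMinGap_pos hA hW hHi hLo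
  obtain ⟨i, hi⟩ := BanditTask.exists_not_isOptimal hA hHi
  have hD1 : BanditTask.jointMinGap Hi Lo ≤ 1 :=
    (BanditTask.jointMinGap_le_hi hi).trans (BanditTask.gap_le_one i)
  have hS : 1 ≤ Hi.invGapSum := by
    have hpos := BanditTask.gap_pos_iff.2 hi
    refine ((one_le_div hpos).2 (BanditTask.gap_le_one i)).trans ?_
    exact Finset.single_le_sum (f := fun i => 1 / Hi.gap i)
      (fun j _ => one_div_nonneg.2 (Hi.gap_nonneg j)) (by simpa using hpos)
  have hW2 : (2 : ℝ) ≤ W := by exact_mod_cast hW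
  have hA2 : (2 : ℝ) ≤ A := by exact_mod_cast hA
  -- `c` is the coefficient of `l` in the cap `11 * c * l` on `log f(k)`: it is `1` for the first
  -- bound and the full constant for the second. The additive terms fit because `invGapSum ≥ 1` and
  -- `l ≥ 1 / 2`, so `invGapSum + 16 ≤ 34 * (invGapSum * l)`.
  have hfinal : ∀ r l c : ℝ, 1 / 2 ≤ l → 0 ≤ c → c ≤ Real.log ((563216 * α) ^ 2) + 5 →
      r ≤ (3200 * α * (11 * c * l) + 1) * Hi.invGapSum + 16 →
      r ≤ (35200 * α * (Real.log ((563216 * α) ^ 2) + 5) + 34) * (Hi.invGapSum * l) := by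
    intro r l c hl hc0 hc hr
    have hSl : Hi.invGapSum ≤ 2 * (Hi.invGapSum * l) := by nlinarith
    have hSl0 : 0 ≤ Hi.invGapSum * l := by nlinarith
    calc r ≤ 35200 * α * c * (Hi.invGapSum * l) + Hi.invGapSum + 16 := by linarith
      _ ≤ 35200 * α * (Real.log ((563216 * α) ^ 2) + 5) * (Hi.invGapSum * l) + Hi.invGapSum + 16 := by
          gcongr
      _ ≤ _ := by linarith
  constructor
  · intro K hK
    have hK1 : (1 : ℝ) ≤ K := by exact_mod_cast hK
    have hl : 1 / 2 ≤ Real.log ((W : ℝ) * K) := by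
      have := Real.log_le_log (by norm_num) (by nlinarith : (2 : ℝ) ≤ W * K)
      linarith [Real.log_two_gt_d9]
    refine hfinal _ _ 1 hl zero_le_one (by linarith) (h.regretHi_le hα hA hW hHi.exists
      (fun w => (hLo w).exists) hdom hΔ (by linarith) fun k hk hkA ω _ => Or.inr ?_)
    rw [mul_one]
    exact (log_confFn_mono A W (Finset.mem_Icc.1 hk).2).trans
      (log_confFn_le hW (hkA.trans_le (Finset.mem_Icc.1 hk).2))
  · intro hclose K hK
    set x := (A : ℝ) * W / BanditTask.jointMinGap Hi Lo
    have hx4 : 4 ≤ x := by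
      rw [le_div_iff₀ hD]
      nlinarith
    have hWx : (W : ℝ) ≤ x := by
      rw [le_div_iff₀ hD]
      nlinarith
    have hl : 1 ≤ Real.log x := by
      have h1 := Real.log_le_log (by norm_num) hx4
      rw [show (4 : ℝ) = 2 ^ 2 by norm_num, Real.log_pow] at h1
      push_cast at h1
      linarith [Real.log_two_gt_d9]
    refine hfinal _ _ _ (by linarith) (by positivity) le_rfl (h.regretHi_le hα hA hW hHi.exists
      (fun w => (hLo w).exists) hdom hΔ (by positivity) fun k hk hkA ω hrec => ?_)
    -- Above the threshold the optimal arm is locked in. Below it, `W * k` is at most a constant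
    -- times `x ^ 5`, which caps `log f(k)` independently of `K`.
    rcases lt_or_ge ((563216 * α) ^ 2 * x ^ 4) (k : ℝ) with hlt | hle
    · exact Or.inl (h.isOptimal_armHi (by linarith) hA hD hHi hLo hdom hΔ hclose hrec
        (exploration_lt hα hA hW hD hD1 hlt))
    · refine Or.inr ((log_confFn_le hW hkA).trans ?_)
      have hk0 : (0 : ℝ) < k := by exact_mod_cast (Finset.mem_Icc.1 hk).1
      have h1 : (W : ℝ) * k ≤ (563216 * α) ^ 2 * x ^ 5 := by
        calc (W : ℝ) * k ≤ x * ((563216 * α) ^ 2 * x ^ 4) := by gcongr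
          _ = _ := by ring
      have h2 := Real.log_le_log (by positivity) h1
      rw [Real.log_mul (x := (563216 * α) ^ 2) (by positivity) (by positivity),
        Real.log_pow x] at h2
      push_cast at h2
      have h3 : Real.log ((563216 * α) ^ 2) ≤ Real.log ((563216 * α) ^ 2) * Real.log x :=
        le_mul_of_one_le_right hC hl
      nlinarith
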